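/- Let $d \ge 0$ be an integer. Let $\mathcal F_d$ be the class of upper semi-continuous functions $f:\mathbb R^d\to[0,\infty)$ with $\int_{\mathbb R^d} f(x)\,dx=1$ such that $\log f:\mathbb R^d\to[-\infty,\infty)$ is concave (with $\log 0:=-\infty$). Let $\mathcal P_d$ be the class of Borel probability measures $P$ on $\mathbb R^d$ with $\int\|x\|\,dP(x)<\infty$ and $P(H)<1$ for every hyperplane $H=\{x: v^\top x=c\}$, $v\ne 0$. A log-concave projection of $P\in\mathcal P_d$ is a function $f^*\in\mathcal F_d$ that maximises $\int \log f\,dP$ (an element of $[-\infty,\infty)$) over $f\in\mathcal F_d$. Let $P\in\mathcal P_d$. Then a log-concave projection $f^*$ of $P$ exists, and for every such $f^*$ the measure $P^*(B):=\int_B f^*(x)\,dx$ satisfies the following. (a) For every convex $h:\mathbb R^d\to(-\infty,\infty]$, the negative part of $h$ has finite integral with respect to both $P^*$ and $P$, and, in $(-\infty,\infty]$, $$\int_{\mathbb R^d} h\,dP^*\le\int_{\mathbb R^d} h\,dP .$$ (b) The mean is preserved: $\int\|x\|\,dP^*(x)<\infty$ and $\int x\,dP^*(x)=\int x\,dP(x)=:\mu$.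 (c) The covariance shrinks: $\int\|x\|^2\,dP^*(x)<\infty$, and for every $v\in\mathbb R^d$ $$\int (v^\top(x-\mu))^2\,dP^*(x)\le\int (v^\top(x-\mu))^2\,dP(x)\in[0,\infty].$$ If moreover $\int\|x\|^2\,dP(x)<\infty$, then the matrix $\int (x-\mu)(x-\mu)^\top dP(x)-\int (x-\mu)(x-\mu)^\top dP^*(x)$ is non-negative definite. -/

import Mathlib

open MeasureTheory
open scoped ENNReal NNReal

namespace LogConcaveProjection

/-- Integral `∫ f⁺ dμ - ∫ f⁻ dμ` of a function with values in `[-∞, ∞]`. It is the usual extended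
integral when `f` is measurable and one of the two terms is finite. -/
noncomputable def extIntegral {Ω : Type*} [MeasurableSpace Ω] (μ : Measure Ω) (f : Ω → EReal) :
    EReal :=
  ((∫⁻ x, (f x).toENNReal ∂μ : ℝ≥0∞) : EReal) - ((∫⁻ x, (-f x).toENNReal ∂μ : ℝ≥0∞) : EReal)

/-- Convex functions `h : E → (-∞, ∞]`. -/
def IsExtConvex {E : Type*} [AddCommGroup E] [Module ℝ E] (h : E → EReal) : Prop :=
  (∀ x, h x ≠ ⊥) ∧
    ∀ x y : E, ∀ a b : ℝ, 0 < a → 0 < b → a + b = 1 →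
      h (a • x + b • y) ≤ (a : EReal) * h x + (b : EReal) * h y

/-- Concave functions `φ : E → [-∞, ∞)`. -/
def IsExtConcave {E : Type*} [AddCommGroup E] [Module ℝ E] (φ : E → EReal) : Prop :=
  (∀ x, φ x ≠ ⊤) ∧
    ∀ x y : E, ∀ a b : ℝ, 0 < a → 0 < b → a + b = 1 →
      (a : EReal) * φ x + (b : EReal) * φ y ≤ φ (a • x + b • y)

/-- `log f`, with `log 0 = -∞`. -/
noncomputable def logFun {E : Type*} (f : E → ℝ≥0) (x : E) : EReal :=
  ENNReal.log (f x : ℝ≥0∞)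

/-- The class `𝓕_d` of upper semicontinuous log-concave densities on `ℝ^d`. -/
structure IsLogConcaveDensity {d : ℕ} (f : EuclideanSpace ℝ (Fin d) → ℝ≥0) : Prop where
  upperSemicontinuous : UpperSemicontinuous f
  logConcave : IsExtConcave (logFun f)
  lintegral_eq_one : ∫⁻ x, (f x : ℝ≥0∞) = 1

/-- The class `𝓟_d` of probability measures on `ℝ^d` with finite first absolute moment that give
mass less than one to every hyperplane. -/
structure MemPd {d : ℕ} (P : Measure (EuclideanSpace ℝ (Fin d))) : Prop where
  isProbabilityMeasure : IsProbabilityMeasure P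
  firstMoment : ∫⁻ x, ‖x‖ₑ ∂P < ∞
  hyperplane : ∀ v : EuclideanSpace ℝ (Fin d), v ≠ 0 → ∀ c : ℝ, P {x | inner ℝ v x = c} < 1

/-- `f` is a log-concave projection of `P`: it maximises `∫ log g dP` over `g ∈ 𝓕_d`. -/
def IsProjection {d : ℕ} (P : Measure (EuclideanSpace ℝ (Fin d)))
    (f : EuclideanSpace ℝ (Fin d) → ℝ≥0) : Prop :=
  IsLogConcaveDensity f ∧
    ∀ g : EuclideanSpace ℝ (Fin d) → ℝ≥0, IsLogConcaveDensity g →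
      extIntegral P (logFun g) ≤ extIntegral P (logFun f)

/-- The measure `B ↦ ∫_B f` with Lebesgue density `f`. -/
noncomputable def densityMeasure {d : ℕ} (f : EuclideanSpace ℝ (Fin d) → ℝ≥0) :
    Measure (EuclideanSpace ℝ (Fin d)) :=
  volume.withDensity (fun x => (f x : ℝ≥0∞))

/-- The matrix `∫ (x - m)(x - m)ᵀ dQ(x)`. -/
noncomputable def secondMomentMatrix {d : ℕ} (Q : Measure (EuclideanSpace ℝ (Fin d)))
    (m : EuclideanSpace ℝ (Fin d)) : Matrix (Fin d) (Fin d) ℝ :=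
  Matrix.of fun i j => ∫ x, (x i - m i) * (x j - m j) ∂Q

end LogConcaveProjection

namespace LogConcaveProjection

open Set Filter Topology

/-! ### Densities as `exp (B - u)` with a convex lower semicontinuous exponent `u ≥ 0` -/

section

/-! A bounded log-concave density is `exp (B - u)` with `u` convex, lower semicontinuous and `[0,
∞]`-valued, and its objective is then `B - ∫ u dP`. All limits can thus be taken with Lebesgue
integrals of non-negative functions.

Existence. Since no hyperplane carries all of `P`, some ball lies in every closed convex set of
`P`-mass close to one (`MemPd.exists_closedBall_subset`). By Markov, a density with objective at
least `L` has a controlled exponent on that ball; a high peak elsewhere would then, by convexity,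
produce total mass above one. So near-maximisers are uniformly bounded
(`MemPd.exists_uniform_bound`). Instead of a compactness theorem, a parallelogram argument gives
convergence: the normalised geometric mean of two near-maximisers is a competitor, which forces `∫
√(f_n f_m)` to be almost one, so `√f_n` is Cauchy in `L²`. The lower semicontinuous hull of `limsup
u_n` is an admissible exponent, lies below `liminf u_n` everywhere, and agrees with `limsup u_n`
almost everywhere; Fatou for `P` and Fatou for Lebesgue measure show that it is optimal.

Convex ordering. For convex lower semicontinuous `H ≥ 0`, compare `f` with the normalisation of `f *
exp (-t H)`. Optimality gives `1 - ∫ exp (-t H) dP* ≤ t ∫ H dP`; dividing by `t` and letting `t → 0`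
gives `∫ H dP* ≤ ∫ H dP` (`IsProjection.lintegral_le`). Positive parts of shifted linear functionals
then show that means agree. For general `h`, either `∫ h dP = ∞`, or `P*` lives on the interior of
the domain of `h`, where `h` is an affine function plus such an `H`; the affine part integrates
equally.

Second moments. Integrability of `exp (-u)` forces `u` to grow linearly, so `P*` has exponential
tails, and squares of affine functions are convex test functions. -/

/-- `exp (-u)` for `u ∈ [0, ∞]`. -/
noncomputable def expNeg (u : ℝ≥0∞) : ℝ≥0∞ := EReal.exp (-(u : EReal))

lemma expNeg_zero : expNeg 0 = 1 := by simp [expNeg]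

lemma expNeg_top : expNeg ∞ = 0 := by simp [expNeg]

lemma expNeg_le_one (u : ℝ≥0∞) : expNeg u ≤ 1 := by
  simp [expNeg, EReal.coe_ennreal_nonneg]

lemma expNeg_ne_top (u : ℝ≥0∞) : expNeg u ≠ ∞ := ((expNeg_le_one u).trans_lt (by simp)).ne

lemma expNeg_antitone : Antitone expNeg := fun a b h => by
  simpa [expNeg] using h

lemma continuous_expNeg : Continuous expNeg :=
  ENNReal.continuous_exp.comp (continuous_neg.comp continuous_coe_ennreal_ereal)

lemma measurable_expNeg : Measurable expNeg := continuous_expNeg.measurable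

lemma expNeg_ofReal {r : ℝ} (hr : 0 ≤ r) :
    expNeg (ENNReal.ofReal r) = ENNReal.ofReal (Real.exp (-r)) := by
  rw [expNeg, EReal.coe_ennreal_ofReal, max_eq_left hr, ← EReal.coe_neg, EReal.exp_coe]

lemma expNeg_pos {u : ℝ≥0∞} (hu : u ≠ ∞) : 0 < expNeg u := by
  simp [expNeg, bot_lt_iff_ne_bot, hu]

lemma expNeg_eq_zero {u : ℝ≥0∞} : expNeg u = 0 ↔ u = ∞ := by
  simp [expNeg]

lemma expNeg_add (u v : ℝ≥0∞) : expNeg (u + v) = expNeg u * expNeg v := by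
  rw [expNeg, expNeg, expNeg, ← EReal.exp_add, EReal.coe_ennreal_add,
    EReal.neg_add (by simp) (by simp), sub_eq_add_neg]

variable {E : Type*} [NormedAddCommGroup E] [NormedSpace ℝ E]

/-- Convex functions with values in `[0, ∞]`. -/
def IsConvexENN (u : E → ℝ≥0∞) : Prop :=
  ∀ x y : E, ∀ a b : ℝ, 0 < a → 0 < b → a + b = 1 →
    u (a • x + b • y) ≤ ENNReal.ofReal a * u x + ENNReal.ofReal b * u y

/-- Convex lower semicontinuous functions with values in `[0, ∞]`. -/
structure IsConvexLsc (u : E → ℝ≥0∞) : Prop where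
  lsc : LowerSemicontinuous u
  convex : IsConvexENN u

lemma IsConvexLsc.measurable [MeasurableSpace E] [BorelSpace E] {u : E → ℝ≥0∞}
    (hu : IsConvexLsc u) : Measurable u := hu.lsc.measurable

lemma IsConvexLsc.add {u v : E → ℝ≥0∞} (hu : IsConvexLsc u) (hv : IsConvexLsc v) :
    IsConvexLsc (fun x => u x + v x) where
  lsc := hu.lsc.add hv.lsc
  convex x y a b ha hb hab := by
    refine (add_le_add (hu.convex x y a b ha hb hab) (hv.convex x y a b ha hb hab)).trans
      (le_of_eq ?_)
    ring

lemma IsConvexLsc.const_mul {u : E → ℝ≥0∞} (hu : IsConvexLsc u) (c : ℝ) :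
    IsConvexLsc (fun x => ENNReal.ofReal c * u x) where
  lsc := (ENNReal.continuous_const_mul ENNReal.ofReal_ne_top).comp_lowerSemicontinuous hu.lsc
    (fun _ _ h => mul_le_mul_right h _)
  convex x y a b ha hb hab := by
    refine (mul_le_mul_right (hu.convex x y a b ha hb hab) _).trans (le_of_eq ?_)
    ring

lemma IsConvexLsc.convex_le {u : E → ℝ≥0∞} (hu : IsConvexLsc u) (s : ℝ≥0∞) :
    Convex ℝ {x | u x ≤ s} := by
  rw [convex_iff_forall_pos]
  intro x hx y hy a b ha hb hab
  refine (hu.convex x y a b ha hb hab).trans ?_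
  calc _ ≤ ENNReal.ofReal a * s + ENNReal.ofReal b * s := by gcongr <;> assumption
    _ = s := by rw [← add_mul, ← ENNReal.ofReal_add ha.le hb.le, hab]; simp

/-- The function `exp (B - u)`. -/
noncomputable def expDensity {E : Type*} (B : ℝ) (u : E → ℝ≥0∞) (x : E) : ℝ≥0 :=
  (EReal.exp ((B : EReal) - u x)).toNNReal

lemma coe_expDensity {E : Type*} (B : ℝ) (u : E → ℝ≥0∞) (x : E) :
    (expDensity B u x : ℝ≥0∞) = EReal.exp ((B : EReal) - u x) := by
  rw [expDensity, ENNReal.coe_toNNReal]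
  rw [Ne, EReal.exp_eq_top_iff]
  have h : (B : EReal) - u x ≤ B := by
    simpa using EReal.sub_le_sub (le_refl (B : EReal)) (EReal.coe_ennreal_nonneg (u x))
  exact (h.trans_lt (EReal.coe_lt_top B)).ne

lemma logFun_expDensity {E : Type*} (B : ℝ) (u : E → ℝ≥0∞) (x : E) :
    logFun (expDensity B u) x = (B : EReal) - u x := by
  rw [logFun, coe_expDensity, EReal.log_exp]

lemma coe_eq_of_logFun {E : Type*} {f : E → ℝ≥0} {B : ℝ} {u : E → ℝ≥0∞} {x : E}
    (h : logFun f x = (B : EReal) - u x) :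
    (f x : ℝ≥0∞) = ENNReal.ofReal (Real.exp B) * expNeg (u x) := by
  have h2 := congrArg EReal.exp h
  rw [logFun, ENNReal.exp_log, sub_eq_add_neg, EReal.exp_add, EReal.exp_coe] at h2
  exact h2

lemma exp_mul_exp_neg_eq_one (B : ℝ) :
    ENNReal.ofReal (Real.exp B) * ENNReal.ofReal (Real.exp (-B)) = 1 := by
  rw [← ENNReal.ofReal_mul (Real.exp_pos B).le, ← Real.exp_add]; simp

section

variable {d : ℕ}

lemma isLogConcaveDensity_expDensity {B : ℝ} {u : EuclideanSpace ℝ (Fin d) → ℝ≥0∞}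
    (hu : IsConvexLsc u) (hInt : ∫⁻ x, expNeg (u x) = ENNReal.ofReal (Real.exp (-B))) :
    IsLogConcaveDensity (expDensity B u) where
  upperSemicontinuous := by
    have h1 : UpperSemicontinuous (fun x => (expDensity B u x : ℝ≥0∞)) := by
      have : (fun x => (expDensity B u x : ℝ≥0∞)) =
          fun x => (fun t => ENNReal.ofReal (Real.exp B) * expNeg t) (u x) := by
        ext x; exact coe_eq_of_logFun (logFun_expDensity B u x)
      rw [this]
      exact ((ENNReal.continuous_const_mul ENNReal.ofReal_ne_top).comp
        continuous_expNeg).comp_lowerSemicontinuous_antitone hu.lsc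
        (fun a b h => mul_le_mul_right (expNeg_antitone h) _)
    intro x c hc
    filter_upwards [h1 x c (by simpa using hc)] with y hy
    simpa using hy
  logConcave := by
    refine ⟨fun x => ?_, fun x y a b ha hb hab => ?_⟩
    · simp [logFun]
    · simp only [logFun_expDensity]
      have hc := hu.convex x y a b ha hb hab
      rcases eq_or_ne (u x) ∞ with hx | hx
      · simp [hx, EReal.coe_mul_bot_of_pos ha]
      rcases eq_or_ne (u y) ∞ with hy | hy
      · simp [hy, EReal.coe_mul_bot_of_pos hb]
      lift u x to ℝ≥0 using hx with p
      lift u y to ℝ≥0 using hy with q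
      have hz : u (a • x + b • y) ≠ ∞ := by
        refine (hc.trans_lt ?_).ne
        finiteness
      lift u (a • x + b • y) to ℝ≥0 using hz with r
      have hc' : (r : ℝ) ≤ a * p + b * q := by
        have := ENNReal.toReal_mono (by finiteness) hc
        rw [ENNReal.toReal_add (by finiteness) (by finiteness)] at this
        simpa [ha.le, hb.le] using this
      have e (s : ℝ≥0) : ((s : ℝ≥0∞) : EReal) = ((s : ℝ) : EReal) := rfl
      rw [e, e, e]
      norm_cast
      have : B = a * B + b * B := by rw [← add_mul, hab, one_mul]
      nlinarith
  lintegral_eq_one := by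
    simp_rw [coe_eq_of_logFun (logFun_expDensity B u _)]
    rw [lintegral_const_mul' _ _ (by finiteness), hInt,
      exp_mul_exp_neg_eq_one]

/-- The exponent `B - log f` of a density bounded by `exp B`. -/
noncomputable def exponent {E : Type*} (B : ℝ) (f : E → ℝ≥0) (x : E) : ℝ≥0∞ :=
  ((B : EReal) - logFun f x).toENNReal

lemma logFun_eq_sub_exponent {E : Type*} {B : ℝ} {f : E → ℝ≥0} {x : E}
    (h : logFun f x ≤ B) : logFun f x = (B : EReal) - exponent B f x := by
  rw [exponent, EReal.coe_toENNReal (EReal.sub_nonneg (by simp) (by simp) |>.2 h)]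
  generalize logFun f x = t at *
  induction t with
  | bot => simp
  | coe r => rw [← EReal.coe_sub, ← EReal.coe_sub, sub_sub_cancel]
  | top => simp at h

lemma isConvexLsc_exponent (B : ℝ) {f : EuclideanSpace ℝ (Fin d) → ℝ≥0}
    (hf : IsLogConcaveDensity f) : IsConvexLsc (exponent B f) where
  lsc := by
    have h1 : UpperSemicontinuous (logFun f) :=
      (ENNReal.continuous_log.comp ENNReal.continuous_coe).comp_upperSemicontinuous
        hf.upperSemicontinuous (fun a b hab => ENNReal.log_monotone (by exact_mod_cast hab))
    have h2 : Continuous fun t : EReal => ((B : EReal) - t).toENNReal := by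
      refine EReal.continuous_toENNReal.comp (g := EReal.toENNReal)
        (f := fun t : EReal => (B : EReal) + -t) ?_
      refine continuous_iff_continuousAt.2 fun t => ?_
      exact (EReal.continuousAt_add (p := ((B : EReal), -t)) (by simp) (by simp)).comp
        (f := fun t : EReal => ((B : EReal), -t))
        (continuousAt_const.prodMk continuous_neg.continuousAt)
    refine h2.comp_upperSemicontinuous_antitone h1 fun a b hab => ?_
    exact EReal.toENNReal_le_toENNReal (EReal.sub_le_sub le_rfl hab)
  convex x y a b ha hb hab := by
    have hc := hf.logConcave.2 x y a b ha hb hab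
    have htop := fun x => hf.logConcave.1 x
    simp only [exponent]
    have hx := htop x
    have hy := htop y
    have hz := htop (a • x + b • y)
    generalize logFun f x = p at *
    generalize logFun f y = q at *
    generalize logFun f (a • x + b • y) = r at *
    induction p with
    | bot => simp [ha]
    | top => exact absurd rfl hx
    | coe p =>
    induction q with
    | bot => simp [hb]
    | top => exact absurd rfl hy
    | coe q =>
    induction r with
    | bot =>
      rw [le_bot_iff] at hc
      exact absurd hc (by norm_cast)
    | top => exact absurd rfl hz
    | coe r =>
    norm_cast at hc
    rw [← EReal.coe_sub, ← EReal.coe_sub, ← EReal.coe_sub,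
      EReal.toENNReal_of_ne_top (EReal.coe_ne_top _),
      EReal.toENNReal_of_ne_top (EReal.coe_ne_top _),
      EReal.toENNReal_of_ne_top (EReal.coe_ne_top _), EReal.toReal_coe, EReal.toReal_coe,
      EReal.toReal_coe, ← ENNReal.ofReal_mul ha.le, ← ENNReal.ofReal_mul hb.le]
    refine le_trans (ENNReal.ofReal_le_ofReal ?_) ENNReal.ofReal_add_le
    have : B = a * B + b * B := by rw [← add_mul, hab, one_mul]
    nlinarith

lemma lintegral_expNeg_exponent {B : ℝ} {f : EuclideanSpace ℝ (Fin d) → ℝ≥0}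
    (hf : IsLogConcaveDensity f) (h : ∀ x, logFun f x ≤ B) :
    ∫⁻ x, expNeg (exponent B f x) = ENNReal.ofReal (Real.exp (-B)) := by
  have h1 : ∀ x, expNeg (exponent B f x) = ENNReal.ofReal (Real.exp (-B)) * f x := fun x => by
    rw [coe_eq_of_logFun (logFun_eq_sub_exponent (h x)), ← mul_assoc, mul_comm (ENNReal.ofReal _),
      exp_mul_exp_neg_eq_one, one_mul]
  simp_rw [h1]
  rw [lintegral_const_mul' _ _ (by finiteness), hf.lintegral_eq_one, mul_one]

end

/-- Pointwise `φ⁺ + (u + B⁻) = φ⁻ + B⁺`, with every term in `[0, ∞]`. This can be integrated without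
subtraction, and since `φ⁺ ≤ B⁺` has finite integral it can be rearranged afterwards even when `∫ u
= ∞`. -/
lemma extIntegral_eq_sub {Ω : Type*} [MeasurableSpace Ω] {P : Measure Ω} [IsProbabilityMeasure P]
    {φ : Ω → EReal} {B : ℝ} {u : Ω → ℝ≥0∞} (hu : Measurable u)
    (h : ∀ x, φ x = (B : EReal) - u x) :
    extIntegral P φ = (B : EReal) - ((∫⁻ x, u x ∂P : ℝ≥0∞) : EReal) := by
  have hp : Measurable fun x => (φ x).toENNReal := by
    have : φ = fun x => (B : EReal) + -(u x : EReal) := by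
      ext x; rw [h]; rfl
    rw [this]
    exact ((measurable_coe_ennreal_ereal.comp hu).neg.const_add _).ereal_toENNReal
  have hpt : ∀ x, (φ x).toENNReal + (u x + ENNReal.ofReal (-B)) =
      (-φ x).toENNReal + ENNReal.ofReal B := by
    intro x
    rw [h]
    rcases eq_or_ne (u x) ∞ with hx | hx
    · simp [hx]
    · lift u x to ℝ≥0 using hx with p
      have e (s : ℝ≥0) : ((s : ℝ≥0∞) : EReal) = ((s : ℝ) : EReal) := rfl
      rw [e, ← EReal.coe_sub, ← EReal.coe_neg, EReal.toENNReal_of_ne_top (EReal.coe_ne_top _),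
        EReal.toENNReal_of_ne_top (EReal.coe_ne_top _), EReal.toReal_coe, EReal.toReal_coe,
        ← ENNReal.ofReal_coe_nnreal (p := p)]
      rcases le_total 0 B with hB | hB
      · rw [ENNReal.ofReal_of_nonpos (p := -B) (by linarith), add_zero]
        rcases le_total (p : ℝ) B with hpB | hpB
        · rw [ENNReal.ofReal_of_nonpos (p := -(B - p)) (by linarith), zero_add,
            ← ENNReal.ofReal_add (by linarith) (by simp)]
          congr 1; ring
        · rw [ENNReal.ofReal_of_nonpos (p := (B - p)) (by linarith), zero_add,
            ← ENNReal.ofReal_add (by linarith) hB]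
          congr 1; ring
      · have := p.coe_nonneg
        rw [ENNReal.ofReal_of_nonpos (p := B) hB, add_zero,
          ENNReal.ofReal_of_nonpos (p := (B - p)) (by linarith), zero_add,
          ← ENNReal.ofReal_add (by linarith) (by linarith)]
        congr 1; ring
  have hInt := congrArg (fun g : Ω → ℝ≥0∞ => ∫⁻ x, g x ∂P) (funext hpt)
  rw [lintegral_add_left hp, lintegral_add_left hu, lintegral_add_right _ measurable_const] at hInt
  simp only [lintegral_const, measure_univ, mul_one] at hInt
  have hfin : ∫⁻ x, (φ x).toENNReal ∂P ≠ ∞ := by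
    have : ∫⁻ x, (φ x).toENNReal ∂P ≤ ∫⁻ _, ENNReal.ofReal B ∂P := by
      refine lintegral_mono fun x => ?_
      have : φ x ≤ B := by
        rw [h]
        exact (EReal.sub_le_sub le_rfl (EReal.coe_ennreal_nonneg _)).trans (by simp)
      refine (EReal.toENNReal_le_toENNReal this).trans ?_
      rw [EReal.toENNReal_of_ne_top (by simp)]; simp
    refine (this.trans_lt ?_).ne
    simp
  rw [extIntegral]
  generalize ∫⁻ x, (φ x).toENNReal ∂P = p at *
  generalize ∫⁻ x, (-φ x).toENNReal ∂P = q at *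
  generalize ∫⁻ x, u x ∂P = r at *
  lift p to ℝ≥0 using hfin
  rcases eq_or_ne r ∞ with rfl | hr
  · have : q = ∞ := by
      by_contra hq
      have : q + ENNReal.ofReal B ≠ ∞ := by finiteness
      exact this (by simpa using hInt.symm)
    subst this
    simp
  · lift r to ℝ≥0 using hr
    have hq : q ≠ ∞ := by
      rintro rfl
      have : (p : ℝ≥0∞) + (r + ENNReal.ofReal (-B)) ≠ ∞ := by finiteness
      simp [hInt] at this
    lift q to ℝ≥0 using hq
    have h2 := congrArg ENNReal.toReal hInt
    rw [ENNReal.toReal_add (by finiteness) (by finiteness),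
      ENNReal.toReal_add (by finiteness) (by finiteness),
      ENNReal.toReal_add (by finiteness) (by finiteness)] at h2
    simp only [ENNReal.coe_toReal, ENNReal.toReal_ofReal'] at h2
    have e (s : ℝ≥0) : ((s : ℝ≥0∞) : EReal) = ((s : ℝ) : EReal) := rfl
    rw [e, e, e]
    norm_cast
    have := max_zero_sub_max_neg_zero_eq_self B
    rw [max_comm (a := B), max_comm (a := -B)] at *
    linarith

end

/-! ### Uniform bounds for densities with large objective -/

section

section

variable {F : Type*} [NormedAddCommGroup F] [InnerProductSpace ℝ F]

/-- A point `w` of the small ball outside `C` is strictly separated from `C` by some `v`. Points of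
`X` exceed `C` in the direction `v` by less than `‖v‖ * ρ`, and so does the hull; but moving `w` by
`ρ` along `v` stays in the large ball and gains exactly that much. -/
lemma closedBall_subset_of_convexHull [CompleteSpace F] {X C : Set F} {z : F} {ρ : ℝ} (hρ : 0 < ρ)
    (hX : Metric.closedBall z (2 * ρ) ⊆ convexHull ℝ X) (hC : Convex ℝ C) (hCc : IsClosed C)
    (hXC : ∀ x ∈ X, ∃ y ∈ C, dist x y < ρ) : Metric.closedBall z ρ ⊆ C := by
  intro w hw
  by_contra hwC
  obtain ⟨f, t, hft, htw⟩ := geometric_hahn_banach_closed_point hC hCc hwC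
  set v := (InnerProductSpace.toDual ℝ F).symm f with hv
  have hfv : ∀ x, f x = inner ℝ v x := fun x => by simp [hv]
  have hX0 : X.Nonempty := by
    rw [← convexHull_nonempty_iff (𝕜 := ℝ)]
    exact ⟨z, hX (Metric.mem_closedBall_self (by positivity))⟩
  have hv0 : v ≠ 0 := by
    intro h0
    obtain ⟨x, hx⟩ := hX0
    obtain ⟨y, hy, -⟩ := hXC x hx
    have := (hft y hy).trans htw
    simp [hfv, h0] at this
  have hvn : 0 < ‖v‖ := norm_pos_iff.2 hv0
  have hsub : X ⊆ {x | f x < f w + ‖v‖ * ρ} := by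
    intro x hx
    obtain ⟨y, hy, hxy⟩ := hXC x hx
    have h1 : f x - f y ≤ ‖v‖ * dist x y := by
      rw [← map_sub, hfv, dist_eq_norm]
      exact real_inner_le_norm _ _
    have h2 := (hft y hy).trans htw
    have h3 : ‖v‖ * dist x y < ‖v‖ * ρ := by gcongr
    simp only [mem_ofPred_eq]
    linarith
  have hconv : Convex ℝ {x | f x < f w + ‖v‖ * ρ} :=
    convex_halfSpace_lt (LinearMap.isLinear (f : F →ₗ[ℝ] ℝ)) _
  have hmem : w + (ρ / ‖v‖) • v ∈ Metric.closedBall z (2 * ρ) := by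
    rw [Metric.mem_closedBall] at hw ⊢
    calc dist (w + (ρ / ‖v‖) • v) z ≤ dist (w + (ρ / ‖v‖) • v) w + dist w z := dist_triangle _ _ _
      _ ≤ ρ + ρ := by
        refine add_le_add ?_ hw
        rw [dist_eq_norm, add_sub_cancel_left, norm_smul, Real.norm_of_nonneg (by positivity),
          div_mul_cancel₀ _ hvn.ne']
      _ = 2 * ρ := by ring
  have := convexHull_min hsub hconv (hX hmem)
  simp only [mem_ofPred_eq, map_add, map_smul, smul_eq_mul] at this
  have h4 : f v = ‖v‖ * ‖v‖ := by rw [hfv, real_inner_self_eq_norm_mul_norm]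
  have h5 : ρ / ‖v‖ * f v = ‖v‖ * ρ := by rw [h4]; field_simp
  linarith

lemma exists_hyperplane_of_affineSpan_ne_top [FiniteDimensional ℝ F] {S : Set F}
    (hS : S.Nonempty) (h : affineSpan ℝ S ≠ ⊤) :
    ∃ v : F, v ≠ 0 ∧ ∃ c : ℝ, S ⊆ {x | inner ℝ v x = c} := by
  obtain ⟨x₀, hx₀⟩ := hS
  have hx₀' : x₀ ∈ affineSpan ℝ S := subset_affineSpan ℝ S hx₀
  have hdir : (affineSpan ℝ S).direction ≠ ⊤ := by
    rwa [Ne, AffineSubspace.direction_eq_top_iff_of_nonempty ⟨x₀, hx₀'⟩]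
  have horth : (affineSpan ℝ S).directionᗮ ≠ ⊥ := by
    rwa [Ne, Submodule.orthogonal_eq_bot_iff]
  obtain ⟨v, hv, hv0⟩ := Submodule.exists_mem_ne_zero_of_ne_bot horth
  refine ⟨v, hv0, inner ℝ v x₀, fun x hx => ?_⟩
  have h1 : x -ᵥ x₀ ∈ (affineSpan ℝ S).direction :=
    AffineSubspace.vsub_mem_direction (subset_affineSpan ℝ S hx) hx₀'
  have h2 := Submodule.inner_left_of_mem_orthogonal h1 hv
  rw [vsub_eq_sub, inner_sub_right, sub_eq_zero] at h2
  exact h2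

end

variable {d : ℕ} {P : Measure (EuclideanSpace ℝ (Fin d))}

/-- The support of `P` spans affinely, so finitely many of its points have a convex hull with
interior. With `ε` below the masses of small balls around these points, a set missing less than `ε`
of the mass meets every one of those balls, and this is enough to contain a ball of the hull. -/
lemma MemPd.exists_closedBall_subset (hP : MemPd P) :
    ∃ (z : EuclideanSpace ℝ (Fin d)) (ρ ε : ℝ), 0 < ρ ∧ 0 < ε ∧ ε ≤ 1 ∧
      ∀ C : Set (EuclideanSpace ℝ (Fin d)), Convex ℝ C → IsClosed C → P Cᶜ < ENNReal.ofReal ε →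
        Metric.closedBall z ρ ⊆ C := by
  have := hP.isProbabilityMeasure
  have hspan : affineSpan ℝ P.support = ⊤ := by
    by_contra h
    obtain ⟨v, hv, c, hc⟩ := exists_hyperplane_of_affineSpan_ne_top
      (Measure.nonempty_support (IsProbabilityMeasure.ne_zero P)) h
    have h1 := hP.hyperplane v hv c
    have h2 : P P.support = 1 := prob_compl_eq_zero_iff (Measure.isClosed_support.measurableSet)
      |>.1 Measure.measure_compl_support
    exact absurd (h2.symm.le.trans (measure_mono hc)) (not_le.2 h1)
  obtain ⟨t, htS, htspan, htind⟩ :=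
    exists_affineIndependent ℝ (EuclideanSpace ℝ (Fin d)) P.support
  have htfin : t.Finite := finite_set_of_fin_dim_affineIndependent ℝ htind
  obtain ⟨z, hz⟩ := interior_convexHull_nonempty_iff_affineSpan_eq_top.2 (htspan.trans hspan)
  obtain ⟨r, hr, hball⟩ := Metric.nhds_basis_closedBall.mem_iff.1 (mem_interior_iff_mem_nhds.1 hz)
  have hpos : 0 < htfin.toFinset.inf fun x => P (Metric.ball x (r / 2)) := by
    rw [Finset.lt_inf_iff (by simp)]
    intro x hx
    exact (Measure.mem_support_iff_forall x).1 (htS (by simpa using hx)) _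
      (Metric.ball_mem_nhds _ (by positivity))
  obtain ⟨ε, hε0, hε⟩ := ENNReal.lt_iff_exists_nnreal_btwn.1 (lt_min hpos zero_lt_one)
  refine ⟨z, r / 2, ε, by positivity, by simpa using hε0, ?_, fun C hC hCc hPC => ?_⟩
  · have := hε.le.trans (min_le_right _ _)
    exact_mod_cast this
  refine closedBall_subset_of_convexHull (X := t) (by positivity) ?_ hC hCc fun x hx => ?_
  · rwa [mul_div_cancel₀ _ two_ne_zero]
  · by_contra! hcon
    have hsub : Metric.ball x (r / 2) ⊆ Cᶜ := fun y hy hyC => by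
      have := hcon y hyC
      rw [Metric.mem_ball, dist_comm] at hy
      linarith
    have h1 : (htfin.toFinset.inf fun x => P (Metric.ball x (r / 2))) ≤ P (Metric.ball x (r / 2)) :=
      Finset.inf_le (f := fun x => P (Metric.ball x (r / 2))) (by simpa using hx)
    have h2 := h1.trans (measure_mono hsub)
    rw [ENNReal.ofReal_coe_nnreal] at hPC
    exact absurd (hPC.trans (hε.trans_le (min_le_left _ _))) (not_lt.2 h2)

/-- The homothety with centre `y` and ratio `l` maps the ball around `z` onto the smaller ball;
convexity is applied along each ray from `y`. -/
lemma IsConvexLsc.le_on_shrunk_ball {u : EuclideanSpace ℝ (Fin d) → ℝ≥0∞} (hu : IsConvexLsc u)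
    {y z : EuclideanSpace ℝ (Fin d)} {ρ : ℝ} {s : ℝ≥0∞}
    (hs : ∀ x ∈ Metric.closedBall z ρ, u x ≤ s) {l : ℝ} (hl : 0 < l) (hl1 : l < 1)
    {w : EuclideanSpace ℝ (Fin d)}
    (hw : w ∈ Metric.closedBall ((1 - l) • y + l • z) (l * ρ)) :
    u w ≤ ENNReal.ofReal (1 - l) * u y + ENNReal.ofReal l * s := by
  set x := z + l⁻¹ • (w - ((1 - l) • y + l • z)) with hx
  have hwx : w = (1 - l) • y + l • x := by
    rw [hx, smul_add, smul_smul, mul_inv_cancel₀ hl.ne', one_smul]; abel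
  have hxb : x ∈ Metric.closedBall z ρ := by
    rw [mem_closedBall_iff_norm] at hw ⊢
    rw [hx, add_sub_cancel_left, norm_smul, norm_inv, Real.norm_of_nonneg hl.le]
    rwa [inv_mul_le_iff₀ hl]
  rw [hwx]
  refine (hu.convex y x (1 - l) l (by linarith) hl (by ring)).trans ?_
  gcongr
  exact hs x hxb

lemma IsConvexLsc.mul_volume_le_lintegral {u : EuclideanSpace ℝ (Fin d) → ℝ≥0∞}
    (hu : IsConvexLsc u) {z : EuclideanSpace ℝ (Fin d)} {ρ : ℝ} {s : ℝ≥0∞}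
    (hs : ∀ x ∈ Metric.closedBall z ρ, u x ≤ s) {l : ℝ} (hl : 0 < l) (hl1 : l < 1)
    (y : EuclideanSpace ℝ (Fin d)) :
    expNeg (ENNReal.ofReal (1 - l) * u y + ENNReal.ofReal l * s) *
      volume (Metric.closedBall (0 : EuclideanSpace ℝ (Fin d)) (l * ρ)) ≤
      ∫⁻ x, expNeg (u x) := by
  rw [← Measure.addHaar_closedBall_center volume ((1 - l) • y + l • z), ← setLIntegral_const]
  refine (setLIntegral_mono_ae' Metric.isClosed_closedBall.measurableSet ?_).trans
    (setLIntegral_le_lintegral _ _)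
  exact ae_of_all _ fun w hw => expNeg_antitone (hu.le_on_shrunk_ball hs hl hl1 hw)

lemma _root_.Convex.interior_nonempty_of_volume_pos {C : Set (EuclideanSpace ℝ (Fin d))}
    (hC : Convex ℝ C) (h : volume C ≠ 0) : (interior C).Nonempty := by
  by_contra hne
  rw [not_nonempty_iff_eq_empty] at hne
  refine h (measure_mono_null ?_ (hC.addHaar_frontier volume))
  rw [frontier, hne, sdiff_empty]
  exact subset_closure

/-- Some sublevel set has positive volume, and a convex set of positive volume has interior because
its frontier is null. -/
lemma IsConvexLsc.exists_le_on_ball {u : EuclideanSpace ℝ (Fin d) → ℝ≥0∞} (hu : IsConvexLsc u)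
    (h : ∫⁻ x, expNeg (u x) ≠ 0) :
    ∃ (z : EuclideanSpace ℝ (Fin d)) (ρ : ℝ) (s : ℝ≥0), 0 < ρ ∧
      ∀ x ∈ Metric.closedBall z ρ, u x ≤ s := by
  obtain ⟨n, hn⟩ : ∃ n : ℕ, volume {x | u x ≤ (n : ℝ≥0∞)} ≠ 0 := by
    by_contra! hcon
    refine h ((lintegral_eq_zero_iff (measurable_expNeg.comp hu.measurable)).2 ?_)
    have h0 : volume (⋃ n : ℕ, {x | u x ≤ (n : ℝ≥0∞)}) = 0 := measure_iUnion_null hcon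
    filter_upwards [measure_eq_zero_iff_ae_notMem.1 h0] with x hx
    simp only [mem_iUnion, mem_ofPred_eq, not_exists, not_le] at hx
    change expNeg (u x) = 0
    rw [expNeg_eq_zero]
    by_contra hne
    obtain ⟨n, hn⟩ := ENNReal.exists_nat_gt hne
    exact absurd (hx n) hn.le.not_gt
  obtain ⟨z, hz⟩ := (hu.convex_le n).interior_nonempty_of_volume_pos hn
  obtain ⟨r, hr, hball⟩ := Metric.nhds_basis_closedBall.mem_iff.1 (mem_interior_iff_mem_nhds.1 hz)
  exact ⟨z, r, n, hr, fun x hx => by simpa using hball hx⟩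

/-- Before `f` is known to be bounded by `exp B`, the exponent truncates where `f` exceeds it, so
only an inequality survives. It suffices for proving boundedness. -/
lemma expNeg_exponent_le {E : Type*} (B : ℝ) (f : E → ℝ≥0) (x : E) :
    expNeg (exponent B f x) ≤ ENNReal.ofReal (Real.exp (-B)) * f x := by
  have h1 : (B : EReal) - logFun f x ≤ exponent B f x := by
    rw [exponent]; exact EReal.coe_toENNReal_eq_max ▸ le_max_right _ _
  calc expNeg (exponent B f x) ≤ EReal.exp (-((B : EReal) - logFun f x)) := by
        rw [expNeg, EReal.exp_le_exp_iff]
        exact EReal.neg_le_neg_iff.2 h1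
    _ = EReal.exp (((-B : ℝ) : EReal) + logFun f x) := by
        rw [EReal.neg_sub (by simp) (by simp), EReal.coe_neg]
    _ = _ := by rw [EReal.exp_add, logFun, ENNReal.exp_log, EReal.exp_coe]

lemma IsLogConcaveDensity.lintegral_expNeg_exponent_le {f : EuclideanSpace ℝ (Fin d) → ℝ≥0}
    (hf : IsLogConcaveDensity f) (B : ℝ) :
    ∫⁻ x, expNeg (exponent B f x) ≤ ENNReal.ofReal (Real.exp (-B)) := by
  refine (lintegral_mono fun x => expNeg_exponent_le B f x).trans ?_
  rw [lintegral_const_mul' _ _ (by finiteness), hf.lintegral_eq_one, mul_one]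

lemma exponent_le_add {E : Type*} (B B' : ℝ) (f : E → ℝ≥0) (x : E) :
    exponent B' f x ≤ exponent B f x + ENNReal.ofReal (B' - B) := by
  have htop : logFun f x ≠ ⊤ := by simp [logFun]
  rw [exponent, exponent]
  generalize logFun f x = t at *
  induction t with
  | bot => simp
  | top => exact absurd rfl htop
  | coe r =>
    rw [← EReal.coe_sub, ← EReal.coe_sub, EReal.toENNReal_of_ne_top (EReal.coe_ne_top _),
      EReal.toENNReal_of_ne_top (EReal.coe_ne_top _), EReal.toReal_coe, EReal.toReal_coe]
    refine le_trans (ENNReal.ofReal_le_ofReal ?_) ENNReal.ofReal_add_le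
    linarith

lemma IsLogConcaveDensity.exists_ne_zero {f : EuclideanSpace ℝ (Fin d) → ℝ≥0}
    (hf : IsLogConcaveDensity f) : ∃ x, f x ≠ 0 := by
  by_contra! h
  have := hf.lintegral_eq_one
  simp [h] at this

lemma IsLogConcaveDensity.lintegral_expNeg_exponent_ne_zero
    {f : EuclideanSpace ℝ (Fin d) → ℝ≥0} (hf : IsLogConcaveDensity f) (B : ℝ) :
    ∫⁻ x, expNeg (exponent B f x) ≠ 0 := by
  intro h0
  replace h0 := (lintegral_eq_zero_iff
    (measurable_expNeg.comp (isConvexLsc_exponent B hf).measurable)).1 h0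
  have h1 := hf.lintegral_eq_one
  have : (fun x => (f x : ℝ≥0∞)) =ᵐ[volume] 0 := by
    filter_upwards [h0] with x hx
    have hx' : exponent B f x = ∞ := expNeg_eq_zero.1 hx
    rw [exponent, EReal.toENNReal_eq_top_iff] at hx'
    by_contra hne
    have hne' : f x ≠ 0 := fun h => hne (by simp [h])
    rw [logFun, ENNReal.log_pos_real (by simpa using hne') (by simp), ← EReal.coe_sub] at hx'
    exact EReal.coe_ne_top _ hx'
  rw [lintegral_congr_ae this] at h1
  simp at h1

lemma exponent_eq_zero {E : Type*} {B : ℝ} {f : E → ℝ≥0} {x : E} (h : (B : EReal) ≤ logFun f x) :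
    exponent B f x = 0 := by
  rw [exponent, EReal.toENNReal_eq_zero_iff]
  exact EReal.sub_nonpos.2 h

lemma IsLogConcaveDensity.exists_logFun_le {f : EuclideanSpace ℝ (Fin d) → ℝ≥0}
    (hf : IsLogConcaveDensity f) : ∃ B : ℝ, ∀ x, logFun f x ≤ B := by
  obtain ⟨z, ρ, s, hρ, hs⟩ := (isConvexLsc_exponent 0 hf).exists_le_on_ball
    (hf.lintegral_expNeg_exponent_ne_zero 0)
  set V := volume (Metric.closedBall (0 : EuclideanSpace ℝ (Fin d)) (1 / 2 * ρ)) with hV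
  have hV0 : 0 < V := Metric.measure_closedBall_pos _ _ (by positivity)
  have hVt : V ≠ ∞ := measure_closedBall_lt_top.ne
  have hV0' : 0 < V.toReal := ENNReal.toReal_pos hV0.ne' hVt
  -- If `log f y > B`, the half-size ball towards `y` gives `exp (-(s + B) / 2) * V ≤ exp (-B)`,
  -- that is `B ≤ s - 2 log V`; this `B` violates it by at least one.
  set B := max 0 (s - 2 * Real.log V.toReal) + 1 with hB
  have hB0 : 0 ≤ B := by positivity
  refine ⟨B, fun y => ?_⟩
  by_contra! hy
  have hsB : ∀ x ∈ Metric.closedBall z ρ, exponent B f x ≤ ENNReal.ofReal (s + B) := by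
    intro x hx
    refine (exponent_le_add 0 B f x).trans ?_
    rw [sub_zero, ENNReal.ofReal_add s.coe_nonneg hB0, ENNReal.ofReal_coe_nnreal]
    gcongr
    exact hs x hx
  have h1 := (isConvexLsc_exponent B hf).mul_volume_le_lintegral hsB (l := 1 / 2) (by norm_num)
    (by norm_num) y
  have hsB0 : 0 ≤ s + B := by positivity
  rw [exponent_eq_zero hy.le, mul_zero, zero_add, ← ENNReal.ofReal_mul (by norm_num),
    expNeg_ofReal (by positivity)] at h1
  have h2 := h1.trans (hf.lintegral_expNeg_exponent_le B)
  have h3 := ENNReal.toReal_mono (by finiteness) h2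
  rw [ENNReal.toReal_mul, ENNReal.toReal_ofReal (Real.exp_pos _).le,
    ENNReal.toReal_ofReal (Real.exp_pos _).le, ← hV, ← Real.exp_log hV0', ← Real.exp_add,
    Real.exp_le_exp] at h3
  have h4 : (s : ℝ) - 2 * Real.log V.toReal ≤ max 0 (s - 2 * Real.log V.toReal) := le_max_right _ _
  linarith

/-- If `∫ log f dP` is bounded below and `log f ≤ B`, then `log f` is bounded below on a ball
that only depends on `P`. -/
lemma exponent_le_on_ball [IsProbabilityMeasure P] {z : EuclideanSpace ℝ (Fin d)} {ρ ε : ℝ}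
    (hε : 0 < ε)
    (hball : ∀ C : Set (EuclideanSpace ℝ (Fin d)), Convex ℝ C → IsClosed C →
      P Cᶜ < ENNReal.ofReal ε → Metric.closedBall z ρ ⊆ C)
    {f : EuclideanSpace ℝ (Fin d) → ℝ≥0} (hf : IsLogConcaveDensity f) {B L : ℝ}
    (hB : ∀ x, logFun f x ≤ B) (hL : (L : EReal) ≤ extIntegral P (logFun f)) :
    L ≤ B ∧ ∀ x ∈ Metric.closedBall z ρ, exponent B f x ≤ ENNReal.ofReal ((2 * (B - L) + 1) / ε) := by
  have hu := isConvexLsc_exponent B hf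
  rw [extIntegral_eq_sub hu.measurable fun x => logFun_eq_sub_exponent (hB x)] at hL
  set J := ∫⁻ x, exponent B f x ∂P with hJ
  have hJt : J ≠ ∞ := by
    intro h
    rw [h] at hL
    simp at hL
  have hJr : J.toReal ≤ B - L := by
    rw [← ENNReal.ofReal_toReal hJt, EReal.coe_ennreal_ofReal, max_eq_left ENNReal.toReal_nonneg]
      at hL
    norm_cast at hL
    linarith
  have hJ0 : 0 ≤ J.toReal := ENNReal.toReal_nonneg
  refine ⟨by linarith, ?_⟩
  -- Markov needs `s * ε > B - L ≥ ∫ u dP`; the `+ 1` keeps this strict, and `s` positive, when `B =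
  -- L`.
  set s := (2 * (B - L) + 1) / ε with hs
  have hs0 : 0 < s := by
    have : 0 < 2 * (B - L) + 1 := by linarith
    positivity
  refine hball {x | exponent B f x ≤ ENNReal.ofReal s} (hu.convex_le _)
    (hu.lsc.isClosed_preimage _) ?_
  have h1 : P {x | exponent B f x ≤ ENNReal.ofReal s}ᶜ ≤
      P {x | ENNReal.ofReal s ≤ exponent B f x} := measure_mono fun x hx => by
    simp only [mem_compl_iff, mem_ofPred_eq, not_le] at hx ⊢
    exact hx.le
  have h2 := mul_meas_ge_le_lintegral (μ := P) hu.measurable (ENNReal.ofReal s)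
  by_contra! hcon
  have h3 : ENNReal.ofReal s * ENNReal.ofReal ε ≤ J :=
    (mul_le_mul_right (hcon.trans h1) _).trans h2
  rw [← ENNReal.ofReal_mul hs0.le, ENNReal.ofReal_le_iff_le_toReal hJt, hs,
    div_mul_cancel₀ _ hε.ne'] at h3
  linarith

lemma MemPd.exists_uniform_bound (hP : MemPd P) (L : ℝ) :
    ∃ B : ℝ, ∀ f, IsLogConcaveDensity f → (L : EReal) ≤ extIntegral P (logFun f) →
      ∀ x, logFun f x ≤ B := by
  have := hP.isProbabilityMeasure
  obtain ⟨z, ρ, ε, hρ, hε, hε1, hball⟩ := hP.exists_closedBall_subset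
  set V := volume (Metric.closedBall (0 : EuclideanSpace ℝ (Fin d)) (ε / 4 * ρ)) with hV
  have hV0 : 0 < V := Metric.measure_closedBall_pos _ _ (by positivity)
  have hVt : V ≠ ∞ := measure_closedBall_lt_top.ne
  have hV0' : 0 < V.toReal := ENNReal.toReal_pos hV0.ne' hVt
  -- With `b = sup log f` and shrinking ratio `ε / 4`, the bound `(2 (b - L) + 1) / ε` on the ball
  -- contributes only `(b - L) / 2 + 1 / 4` to the exponent. Adding at most `1` for `y`, the mass
  -- bound reads `b ≤ 5 / 4 + (b - L) / 2 - log V`, which is solved for `b`.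
  refine ⟨5 / 2 - L - 2 * Real.log V.toReal, fun f hf hL => ?_⟩
  obtain ⟨B₀, hB₀⟩ := hf.exists_logFun_le
  obtain ⟨x₀, hx₀⟩ := hf.exists_ne_zero
  have hsup_top : ⨆ x, logFun f x ≠ ⊤ := ((iSup_le hB₀).trans_lt (EReal.coe_lt_top _)).ne
  have hsup_bot : ⨆ x, logFun f x ≠ ⊥ := by
    refine (lt_of_lt_of_le ?_ (le_iSup (logFun f) x₀)).ne'
    rw [logFun, ENNReal.bot_lt_log_iff]
    exact_mod_cast pos_iff_ne_zero.2 hx₀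
  obtain ⟨b, hb⟩ : ∃ b : ℝ, (b : EReal) = ⨆ x, logFun f x :=
    ⟨_, EReal.coe_toReal hsup_top hsup_bot⟩
  have hfb : ∀ x, logFun f x ≤ b := fun x => hb ▸ le_iSup (logFun f) x
  obtain ⟨y, hy⟩ : ∃ y, ((b - 1 : ℝ) : EReal) < logFun f y := by
    rw [← lt_iSup_iff, ← hb]
    exact_mod_cast sub_one_lt b
  have huy : exponent b f y ≤ 1 := by
    have := exponent_le_add (b - 1) b f y
    rw [exponent_eq_zero hy.le] at this
    simpa using this
  obtain ⟨hLb, hs⟩ := exponent_le_on_ball hε hball hf hfb hL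
  have h1 := (isConvexLsc_exponent b hf).mul_volume_le_lintegral hs (l := ε / 4) (by positivity)
    (by linarith) y
  have hs0 : 0 ≤ (2 * (b - L) + 1) / ε := div_nonneg (by linarith) hε.le
  have h2 : expNeg (ENNReal.ofReal (1 + (2 * (b - L) + 1) / 4)) ≤ expNeg
      (ENNReal.ofReal (1 - ε / 4) * exponent b f y + ENNReal.ofReal (ε / 4) *
        ENNReal.ofReal ((2 * (b - L) + 1) / ε)) := by
    apply expNeg_antitone
    rw [ENNReal.ofReal_add (by norm_num) (by linarith)]
    refine add_le_add ?_ ?_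
    · calc _ ≤ ENNReal.ofReal 1 * 1 := by
            gcongr
            linarith
        _ = _ := by simp
    · rw [← ENNReal.ofReal_mul (by positivity)]
      apply ENNReal.ofReal_le_ofReal
      apply le_of_eq
      field_simp
  rw [expNeg_ofReal (by linarith)] at h2
  have h3 := ((mul_le_mul_left h2 _).trans h1).trans (hf.lintegral_expNeg_exponent_le b)
  have h4 := ENNReal.toReal_mono (by finiteness) h3
  rw [ENNReal.toReal_mul, ENNReal.toReal_ofReal (Real.exp_pos _).le,
    ENNReal.toReal_ofReal (Real.exp_pos _).le, ← hV, ← Real.exp_log hV0', ← Real.exp_add,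
    Real.exp_le_exp] at h4
  intro x
  refine (hfb x).trans ?_
  norm_cast
  linarith

end

/-! ### Limsups, lower semicontinuous hulls, and a reference density -/

section

section Hull

variable {E : Type*} [NormedAddCommGroup E] [NormedSpace ℝ E]

lemma ofReal_mul_add_const {a b : ℝ} (ha : 0 < a) (hb : 0 < b) (hab : a + b = 1)
    (p q e : ℝ≥0∞) : ENNReal.ofReal a * (p + e) + ENNReal.ofReal b * (q + e) =
      ENNReal.ofReal a * p + ENNReal.ofReal b * q + e := by
  have : ENNReal.ofReal a + ENNReal.ofReal b = 1 := by
    rw [← ENNReal.ofReal_add ha.le hb.le, hab, ENNReal.ofReal_one]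
  calc _ = ENNReal.ofReal a * p + ENNReal.ofReal b * q + (ENNReal.ofReal a + ENNReal.ofReal b) * e
        := by ring
    _ = _ := by rw [this, one_mul]

/-- Strict upper bounds are what pass through limsups, liminfs and infima: they hold eventually,
frequently, or at some witness. -/
lemma isConvexENN_of_forall_lt {u : E → ℝ≥0∞}
    (h : ∀ x y : E, ∀ a b : ℝ, 0 < a → 0 < b → a + b = 1 → ∀ p q : ℝ≥0∞, u x < p → u y < q →
      u (a • x + b • y) ≤ ENNReal.ofReal a * p + ENNReal.ofReal b * q) : IsConvexENN u := by
  intro x y a b ha hb hab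
  rcases eq_or_ne (u x) ∞ with hx | hx
  · simp [hx, ha]
  rcases eq_or_ne (u y) ∞ with hy | hy
  · simp [hy, hb]
  refine ENNReal.le_of_forall_pos_le_add fun e he _ => ?_
  have he' : (e : ℝ≥0∞) ≠ 0 := by simpa using he.ne'
  rw [← ofReal_mul_add_const ha hb hab]
  exact h x y a b ha hb hab _ _ (ENNReal.lt_add_right hx he') (ENNReal.lt_add_right hy he')

/-- Both upper bounds hold eventually, hence simultaneously. A liminf would give them only along
possibly different subsequences, which is why the limiting exponent is built from the limsup. -/
lemma isConvexENN_limsup {u : ℕ → E → ℝ≥0∞} (hu : ∀ n, IsConvexENN (u n)) :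
    IsConvexENN fun x => limsup (fun n => u n x) atTop := by
  refine isConvexENN_of_forall_lt fun x y a b ha hb hab p q hp hq => ?_
  refine limsup_le_of_le (by isBoundedDefault) ?_
  filter_upwards [eventually_lt_of_limsup_lt hp, eventually_lt_of_limsup_lt hq] with n h1 h2
  refine (hu n x y a b ha hb hab).trans ?_
  gcongr

/-- The lower semicontinuous hull. -/
noncomputable def lscHull {E : Type*} [TopologicalSpace E] (w : E → ℝ≥0∞) (x : E) : ℝ≥0∞ := liminf w (𝓝 x)

lemma lowerSemicontinuous_lscHull {E : Type*} [TopologicalSpace E] (w : E → ℝ≥0∞) :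
    LowerSemicontinuous (lscHull w) := by
  intro x c hc
  obtain ⟨c', hc1, hc2⟩ := exists_between hc
  have h1 : ∀ᶠ y in 𝓝 x, c' < w y := eventually_lt_of_lt_liminf hc2
  filter_upwards [eventually_eventually_nhds.2 h1] with y hy
  refine hc1.trans_le (le_liminf_of_le (by isBoundedDefault) ?_)
  filter_upwards [hy] with z hz using hz.le

lemma isConvexLsc_lscHull {w : E → ℝ≥0∞} (hw : IsConvexENN w) : IsConvexLsc (lscHull w) where
  lsc := lowerSemicontinuous_lscHull w
  convex := by
    refine isConvexENN_of_forall_lt fun x y a b ha hb hab p q hp hq => ?_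
    refine liminf_le_of_frequently_le ?_ (by isBoundedDefault)
    intro hcon
    have hx : ∃ᶠ x' in 𝓝 x, w x' < p := frequently_lt_of_liminf_lt (by isBoundedDefault) hp
    have hy : ∃ᶠ y' in 𝓝 y, w y' < q := frequently_lt_of_liminf_lt (by isBoundedDefault) hq
    have ht : Tendsto (fun r : E × E => a • r.1 + b • r.2) (𝓝 x ×ˢ 𝓝 y) (𝓝 (a • x + b • y)) := by
      rw [← nhds_prod_eq]
      have : Continuous (fun r : E × E => a • r.1 + b • r.2) := by fun_prop
      exact this.tendsto (x, y)
    -- Two frequent events cannot be intersected, but here they concern independent variables: `x'`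
    -- is fixed so that almost all `y'` near `y` are good, then `y'` is chosen.
    obtain ⟨x', hx', hx''⟩ := (hx.and_eventually (ht.eventually hcon).curry).exists
    obtain ⟨y', hy', hy''⟩ := (hy.and_eventually hx'').exists
    refine hy'' ((hw x' y' a b ha hb hab).trans ?_)
    gcongr

lemma IsConvexENN.convex_lt_top {w : E → ℝ≥0∞} (hw : IsConvexENN w) :
    Convex ℝ {x | w x < ∞} := by
  rw [convex_iff_forall_pos]
  intro x hx y hy a b ha hb hab
  refine (hw x y a b ha hb hab).trans_lt ?_
  simp only [mem_ofPred_eq] at hx hy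
  finiteness

lemma IsConvexENN.convexOn_toReal {w : E → ℝ≥0∞} (hw : IsConvexENN w) :
    ConvexOn ℝ {x | w x < ∞} fun x => (w x).toReal := by
  rw [convexOn_iff_forall_pos]
  refine ⟨hw.convex_lt_top, fun x hx y hy a b ha hb hab => ?_⟩
  simp only [mem_ofPred_eq] at hx hy
  have h := ENNReal.toReal_mono (by finiteness) (hw x y a b ha hb hab)
  rw [ENNReal.toReal_add (by finiteness) (by finiteness)] at h
  simpa [ha.le, hb.le] using h

/-- A convex function is continuous inside its domain and locally constant `∞` outside the closure.
Hence the hull can change it only on the frontier of a convex set, which is Lebesgue null. -/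
lemma IsConvexENN.lscHull_eq [FiniteDimensional ℝ E] {w : E → ℝ≥0∞} (hw : IsConvexENN w) {x : E}
    (hx : x ∉ frontier {x | w x < ∞}) : lscHull w x = w x := by
  suffices h : Tendsto w (𝓝 x) (𝓝 (w x)) from h.liminf_eq
  by_cases hInt : x ∈ interior {x | w x < ∞}
  · have h1 : ContinuousAt (fun x => (w x).toReal) x :=
      (hw.convexOn_toReal.continuousOn_interior).continuousAt (isOpen_interior.mem_nhds hInt)
    have h2 := (ENNReal.continuous_ofReal.tendsto _).comp h1
    rw [ENNReal.ofReal_toReal (interior_subset hInt).ne] at h2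
    refine h2.congr' ?_
    filter_upwards [mem_interior_iff_mem_nhds.1 hInt] with y hy
    exact ENNReal.ofReal_toReal (ne_of_lt hy)
  · have hcl : x ∈ (closure {x | w x < ∞})ᶜ := fun h => hx ⟨h, hInt⟩
    have h1 : ∀ᶠ y in 𝓝 x, ∞ = w y := by
      filter_upwards [isClosed_closure.isOpen_compl.mem_nhds hcl] with y hy
      by_contra hne
      exact hy (subset_closure (lt_top_iff_ne_top.2 (Ne.symm hne)))
    rw [← h1.self_of_nhds]
    exact tendsto_const_nhds.congr' h1

end Hull

variable {d : ℕ} {P : Measure (EuclideanSpace ℝ (Fin d))}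

lemma exists_density_extIntegral_eq [IsProbabilityMeasure P]
    {v : EuclideanSpace ℝ (Fin d) → ℝ≥0∞} (hv : IsConvexLsc v)
    (h0 : ∫⁻ x, expNeg (v x) ≠ 0) (ht : ∫⁻ x, expNeg (v x) ≠ ∞) :
    ∃ g, IsLogConcaveDensity g ∧ extIntegral P (logFun g) =
      ((-Real.log (∫⁻ x, expNeg (v x)).toReal : ℝ) : EReal) - ((∫⁻ x, v x ∂P : ℝ≥0∞) : EReal) := by
  refine ⟨expDensity (-Real.log (∫⁻ x, expNeg (v x)).toReal) v,
    isLogConcaveDensity_expDensity hv ?_, extIntegral_eq_sub hv.measurable (logFun_expDensity _ _)⟩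
  rw [neg_neg, Real.exp_log (ENNReal.toReal_pos h0 ht), ENNReal.ofReal_toReal ht]

lemma exp_neg_mul_le_rpow {a : ℝ} (ha : 0 < a) (n : ℕ) :
    ∃ C : ℝ, 0 < C ∧ ∀ t : ℝ, 0 ≤ t → Real.exp (-(a * t)) ≤ C * (1 + t) ^ (-(n : ℝ)) := by
  refine ⟨n.factorial * Real.exp a / a ^ n, by positivity, fun t ht => ?_⟩
  have h1 := Real.pow_div_factorial_le_exp (a * (1 + t)) (by positivity) n
  rw [Real.rpow_neg (by positivity), Real.rpow_natCast]
  rw [mul_add, mul_one, Real.exp_add, div_le_iff₀ (by positivity), ← mul_one_add, mul_pow] at h1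
  rw [Real.exp_neg, ← div_eq_mul_inv, inv_eq_one_div, div_div,
    div_le_div_iff₀ (by positivity) (by positivity)]
  linarith

lemma lintegral_expNeg_enorm_lt_top :
    ∫⁻ x : EuclideanSpace ℝ (Fin d), expNeg ‖x‖ₑ < ∞ := by
  obtain ⟨C, hC, h⟩ := exp_neg_mul_le_rpow one_pos (d + 1)
  have hInt : Integrable (fun x : EuclideanSpace ℝ (Fin d) =>
      C * (1 + ‖x‖) ^ (-((d + 1 : ℕ) : ℝ))) :=
    (integrable_one_add_norm (by simp)).const_mul C
  refine lt_of_le_of_lt (lintegral_mono fun x => ?_) hInt.lintegral_lt_top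
  rw [← ofReal_norm, expNeg_ofReal (norm_nonneg x)]
  exact ENNReal.ofReal_le_ofReal (by simpa using h ‖x‖ (norm_nonneg x))

lemma isConvexLsc_enorm {E : Type*} [NormedAddCommGroup E] [NormedSpace ℝ E] :
    IsConvexLsc fun x : E => ‖x‖ₑ where
  lsc := continuous_enorm.lowerSemicontinuous
  convex x y a b ha hb hab := by
    refine (enorm_add_le _ _).trans ?_
    rw [enorm_smul, enorm_smul, Real.enorm_of_nonneg ha.le, Real.enorm_of_nonneg hb.le]

/-- The density proportional to `exp (-‖x‖)` has finite objective, because the first moment of `P`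
is finite; so the supremum is not `-∞`. -/
lemma MemPd.exists_extIntegral_ge (hP : MemPd P) :
    ∃ (L : ℝ) (g : EuclideanSpace ℝ (Fin d) → ℝ≥0),
      IsLogConcaveDensity g ∧ (L : EReal) ≤ extIntegral P (logFun g) := by
  have := hP.isProbabilityMeasure
  have hne : ∫⁻ x : EuclideanSpace ℝ (Fin d), expNeg ‖x‖ₑ ≠ 0 := by
    intro h
    have h1 := (lintegral_eq_zero_iff
      (measurable_expNeg.comp (isConvexLsc_enorm (E := EuclideanSpace ℝ (Fin d))).measurable)).1 h
    obtain ⟨x, hx⟩ := h1.exists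
    exact (expNeg_pos (enorm_ne_top (x := x))).ne' hx
  obtain ⟨g, hg, hgL⟩ := exists_density_extIntegral_eq (P := P) isConvexLsc_enorm hne
    lintegral_expNeg_enorm_lt_top.ne
  refine ⟨-Real.log (∫⁻ x : EuclideanSpace ℝ (Fin d), expNeg ‖x‖ₑ).toReal -
    (∫⁻ x, ‖x‖ₑ ∂P).toReal, g, hg, ?_⟩
  rw [hgL, EReal.coe_sub, EReal.coe_ennreal_toReal hP.firstMoment.ne]

end

/-! ### Existence of a maximiser -/

section

variable {d : ℕ} {P : Measure (EuclideanSpace ℝ (Fin d))}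

section Limit

variable {u : ℕ → EuclideanSpace ℝ (Fin d) → ℝ≥0∞}

/-- If `liminf u_n x < r` while the limsup exceeds `r' > r` near `x`, then for infinitely many `n`
convexity and the common bound `s` keep `u_n` below `r'` on a small ball near `x`. That ball has
positive volume, so it contains a point where the sequence converges, and there the two bounds
contradict each other. -/
lemma lscHull_limsup_le_liminf (hu : ∀ n, IsConvexLsc (u n)) {z : EuclideanSpace ℝ (Fin d)}
    {ρ : ℝ} (hρ : 0 < ρ) {s : ℝ≥0∞} (hst : s ≠ ∞)
    (hs : ∀ n, ∀ x ∈ Metric.closedBall z ρ, u n x ≤ s)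
    (hlim : ∀ᵐ x, ∃ l, Tendsto (fun n => u n x) atTop (𝓝 l)) (x : EuclideanSpace ℝ (Fin d)) :
    lscHull (fun x => limsup (fun n => u n x) atTop) x ≤ liminf (fun n => u n x) atTop := by
  refine le_of_forall_gt_imp_ge_of_dense fun r hr => ?_
  by_contra! hcon
  obtain ⟨r', hr1, hr2⟩ := exists_between hcon
  have hrt : r ≠ ∞ := hcon.ne_top
  have hw : ∀ᶠ y in 𝓝 x, r' < limsup (fun n => u n y) atTop := eventually_lt_of_lt_liminf hr2
  obtain ⟨η, hη, hball⟩ := Metric.eventually_nhds_iff.1 hw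
  have h1 : ∀ᶠ l in 𝓝[>] (0 : ℝ), ENNReal.ofReal (1 - l) * r + ENNReal.ofReal l * s < r' := by
    have ht : Tendsto (fun l : ℝ => ENNReal.ofReal (1 - l) * r + ENNReal.ofReal l * s) (𝓝[>] 0)
        (𝓝 (ENNReal.ofReal (1 - 0) * r + ENNReal.ofReal 0 * s)) := by
      refine tendsto_nhdsWithin_of_tendsto_nhds (Tendsto.add ?_ ?_)
      · refine ENNReal.Tendsto.mul_const ?_ (Or.inr hrt)
        exact (ENNReal.continuous_ofReal.comp (continuous_const.sub continuous_id)).tendsto 0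
      · refine ENNReal.Tendsto.mul_const ?_ (Or.inr hst)
        exact ENNReal.continuous_ofReal.tendsto 0
    refine ht.eventually_lt_const ?_
    simpa using hr1
  have h2 : ∀ᶠ l in 𝓝[>] (0 : ℝ), l * ‖z - x‖ + l * ρ < η := by
    have ht : Tendsto (fun l : ℝ => l * ‖z - x‖ + l * ρ) (𝓝[>] 0) (𝓝 (0 * ‖z - x‖ + 0 * ρ)) := by
      refine tendsto_nhdsWithin_of_tendsto_nhds ?_
      have : Continuous fun l : ℝ => l * ‖z - x‖ + l * ρ := by fun_prop
      exact this.tendsto 0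
    refine ht.eventually_lt_const ?_
    simpa using hη
  have h3 : ∀ᶠ l in 𝓝[>] (0 : ℝ), l < 1 :=
    tendsto_nhdsWithin_of_tendsto_nhds tendsto_id |>.eventually_lt_const one_pos
  obtain ⟨l, h1, h2, h3, hl⟩ := (h1.and (h2.and (h3.and self_mem_nhdsWithin))).exists
  replace hl : 0 < l := hl
  obtain ⟨y, hy, l', hl'⟩ : ∃ y ∈ Metric.closedBall ((1 - l) • x + l • z) (l * ρ),
      ∃ l', Tendsto (fun n => u n y) atTop (𝓝 l') := by
    by_contra! hne
    have hpos : 0 < volume (Metric.closedBall ((1 - l) • x + l • z) (l * ρ)) :=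
      Metric.measure_closedBall_pos _ _ (by positivity)
    refine hpos.ne' (measure_mono_null (fun y hy => ?_) hlim)
    simp only [mem_compl_iff, mem_ofPred_eq, not_exists]
    exact hne y hy
  have hyx : dist y x < η := by
    refine lt_of_le_of_lt ?_ h2
    refine (dist_triangle _ ((1 - l) • x + l • z) _).trans ?_
    rw [add_comm]
    refine add_le_add (le_of_eq ?_) hy
    rw [dist_eq_norm, show (1 - l) • x + l • z - x = l • (z - x) by module, norm_smul,
      Real.norm_of_nonneg hl.le]
  have hfreq : ∃ᶠ n in atTop, u n y ≤ ENNReal.ofReal (1 - l) * r + ENNReal.ofReal l * s := by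
    have : ∃ᶠ n in atTop, u n x < r := frequently_lt_of_liminf_lt (by isBoundedDefault) hr
    refine this.mono fun n hn => ((hu n).le_on_shrunk_ball (hs n) hl h3 hy).trans ?_
    gcongr
  have h4 : liminf (fun n => u n y) atTop ≤ ENNReal.ofReal (1 - l) * r + ENNReal.ofReal l * s :=
    liminf_le_of_frequently_le hfreq (by isBoundedDefault)
  have h5 := hball hyx
  rw [hl'.limsup_eq] at h5
  rw [hl'.liminf_eq] at h4
  exact absurd (h4.trans_lt h1) h5.not_gt

/-- Off a null set the hull is the limsup, `exp (-·)` turns limsup into liminf, and Fatou applies.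
-/
lemma lintegral_expNeg_lscHull_le (hu : ∀ n, IsConvexLsc (u n)) :
    ∫⁻ x, expNeg (lscHull (fun x => limsup (fun n => u n x) atTop) x) ≤
      liminf (fun n => ∫⁻ x, expNeg (u n x)) atTop := by
  have hw := isConvexENN_limsup fun n => (hu n).convex
  refine le_trans (le_of_eq (lintegral_congr_ae ?_))
    (lintegral_liminf_le fun n => measurable_expNeg.comp (hu n).measurable)
  filter_upwards [measure_eq_zero_iff_ae_notMem.1 (hw.convex_lt_top.addHaar_frontier volume)]
    with x hx
  rw [hw.lscHull_eq hx]
  exact expNeg_antitone.map_limsup_of_continuousAt _ continuous_expNeg.continuousAt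

end Limit

/-- `exp (-u / 2)`, as a real number. -/
noncomputable def sqrtExpNeg (u : ℝ≥0∞) : ℝ := (expNeg (ENNReal.ofReal (1 / 2) * u)).toReal

lemma measurable_sqrtExpNeg : Measurable sqrtExpNeg :=
  (measurable_expNeg.comp (measurable_const_mul _)).ennreal_toReal

lemma half_add_half (u : ℝ≥0∞) : ENNReal.ofReal (1 / 2) * u + ENNReal.ofReal (1 / 2) * u = u := by
  rw [← add_mul, ← ENNReal.ofReal_add (by norm_num) (by norm_num)]; norm_num

/-- The identity `(√p - √q)² + 2 √(p q) = p + q`, in subtraction-free form: the cross term of the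
Hellinger distance is the exponential of the midpoint exponent. -/
lemma enorm_sqrtExpNeg_sub_sq (u v : ℝ≥0∞) :
    ‖sqrtExpNeg u - sqrtExpNeg v‖ₑ ^ (2 : ℝ) +
      2 * expNeg (ENNReal.ofReal (1 / 2) * u + ENNReal.ofReal (1 / 2) * v) =
      expNeg u + expNeg v := by
  nth_rw 3 [← half_add_half u]
  nth_rw 3 [← half_add_half v]
  rw [expNeg_add, expNeg_add, expNeg_add, sqrtExpNeg, sqrtExpNeg]
  have h1 := expNeg_ne_top (ENNReal.ofReal (1 / 2) * u)
  have h2 := expNeg_ne_top (ENNReal.ofReal (1 / 2) * v)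
  generalize expNeg (ENNReal.ofReal (1 / 2) * u) = p at *
  generalize expNeg (ENNReal.ofReal (1 / 2) * v) = q at *
  lift p to ℝ≥0 using h1
  lift q to ℝ≥0 using h2
  rw [← ofReal_norm, ENNReal.ofReal_rpow_of_nonneg (norm_nonneg _) (by norm_num)]
  have e2 : (2 : ℝ≥0∞) = ENNReal.ofReal 2 := by simp
  rw [e2, ← ENNReal.ofReal_coe_nnreal (p := p), ← ENNReal.ofReal_coe_nnreal (p := q),
    ← ENNReal.ofReal_mul (by positivity), ← ENNReal.ofReal_mul (by positivity),
    ← ENNReal.ofReal_mul (by positivity), ← ENNReal.ofReal_mul (by positivity),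
    ← ENNReal.ofReal_add (by positivity) (by positivity),
    ← ENNReal.ofReal_add (by positivity) (by positivity)]
  congr 1
  rw [Real.rpow_two, Real.norm_eq_abs, sq_abs]
  simp only [ENNReal.toReal_ofReal (NNReal.coe_nonneg _)]
  ring

lemma eLpNorm_sqrtExpNeg_sub_le {u v : EuclideanSpace ℝ (Fin d) → ℝ≥0∞} (hu : Measurable u)
    (hv : Measurable v) {κ δ : ℝ} (hκ : 0 < κ) (hδ : 0 ≤ δ)
    (hu1 : ∫⁻ x, expNeg (u x) = ENNReal.ofReal κ) (hv1 : ∫⁻ x, expNeg (v x) = ENNReal.ofReal κ)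
    (hc : ENNReal.ofReal (κ * (1 - δ)) ≤
      ∫⁻ x, expNeg (ENNReal.ofReal (1 / 2) * u x + ENNReal.ofReal (1 / 2) * v x)) :
    eLpNorm ((fun x => sqrtExpNeg (u x)) - fun x => sqrtExpNeg (v x)) 2 volume ≤
      ENNReal.ofReal (Real.sqrt (2 * κ * δ)) := by
  have h1 := lintegral_congr (μ := volume)
    (fun x => enorm_sqrtExpNeg_sub_sq (u x) (v x))
  have hm : Measurable fun x =>
      expNeg (ENNReal.ofReal (1 / 2) * u x + ENNReal.ofReal (1 / 2) * v x) :=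
    measurable_expNeg.comp ((hu.const_mul _).add (hv.const_mul _))
  rw [lintegral_add_right _ (hm.const_mul 2), lintegral_const_mul _ hm,
    lintegral_add_left (by exact measurable_expNeg.comp hu), hu1, hv1] at h1
  rw [eLpNorm_eq_lintegral_rpow_enorm_toReal (by norm_num) (by norm_num)]
  simp only [ENNReal.toReal_ofNat, Pi.sub_apply]
  set X := ∫⁻ x, ‖sqrtExpNeg (u x) - sqrtExpNeg (v x)‖ₑ ^ (2 : ℝ) with hX
  set c := ∫⁻ x, expNeg (ENNReal.ofReal (1 / 2) * u x + ENNReal.ofReal (1 / 2) * v x) with hcdef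
  have hXt : X ≠ ∞ := by
    intro h
    rw [h, top_add] at h1
    exact absurd h1.symm (by finiteness)
  have hct : c ≠ ∞ := by
    intro h
    rw [h] at h1
    have : (2 : ℝ≥0∞) * ∞ = ∞ := by simp
    rw [this, add_top] at h1
    exact absurd h1.symm (by finiteness)
  have h2 : X.toReal ≤ 2 * κ * δ := by
    have h3 := congrArg ENNReal.toReal h1
    rw [ENNReal.toReal_add hXt (by finiteness), ENNReal.toReal_mul,
      ENNReal.toReal_add (by finiteness) (by finiteness), ENNReal.toReal_ofReal hκ.le] at h3
    have h4 := (ENNReal.ofReal_le_iff_le_toReal hct).1 hc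
    simp only [ENNReal.toReal_ofNat] at h3
    linarith
  rw [Real.sqrt_eq_rpow, ← ENNReal.ofReal_rpow_of_nonneg (by positivity) (by norm_num)]
  refine ENNReal.rpow_le_rpow ?_ (by norm_num)
  rw [← ENNReal.ofReal_toReal hXt]
  exact ENNReal.ofReal_le_ofReal h2

lemma exists_tendsto_of_sqrtExpNeg {u : ℕ → ℝ≥0∞} {l : ℝ}
    (h : Tendsto (fun n => sqrtExpNeg (u n)) atTop (𝓝 l)) :
    ∃ l', Tendsto u atTop (𝓝 l') := by
  have h1 : Tendsto (fun n => expNeg (ENNReal.ofReal (1 / 2) * u n)) atTop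
      (𝓝 (ENNReal.ofReal l)) := by
    have := (ENNReal.continuous_ofReal.tendsto l).comp h
    refine this.congr fun n => ?_
    simp only [Function.comp, sqrtExpNeg]
    exact ENNReal.ofReal_toReal (expNeg_ne_top _)
  have h2 : Tendsto (fun n => ENNReal.ofReal (1 / 2) * u n) atTop
      (𝓝 (-(ENNReal.log (ENNReal.ofReal l))).toENNReal) := by
    have hc : Continuous fun t : ℝ≥0∞ => (-(ENNReal.log t)).toENNReal :=
      EReal.continuous_toENNReal.comp (continuous_neg.comp ENNReal.continuous_log)
    refine ((hc.tendsto _).comp h1).congr fun n => ?_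
    simp only [Function.comp, expNeg, EReal.log_exp, neg_neg, EReal.toENNReal_coe]
  refine ⟨_, (h2.add h2).congr fun n => half_add_half (u n)⟩

/-- The supremum of `∫ log f dP` over `𝓕_d` is finite, and is approached with any prescribed
rate. -/
lemma MemPd.exists_maximizing_seq (hP : MemPd P) {δ : ℕ → ℝ} (hδ : ∀ n, 0 < δ n) :
    ∃ (M : ℝ) (f : ℕ → EuclideanSpace ℝ (Fin d) → ℝ≥0),
      (∀ g, IsLogConcaveDensity g → extIntegral P (logFun g) ≤ M) ∧
      (∀ n, IsLogConcaveDensity (f n)) ∧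
      ∀ n, ((M - δ n : ℝ) : EReal) ≤ extIntegral P (logFun (f n)) := by
  have := hP.isProbabilityMeasure
  obtain ⟨L, g₀, hg₀, hL⟩ := hP.exists_extIntegral_ge
  obtain ⟨B, hB⟩ := hP.exists_uniform_bound L
  have hle : ∀ g, IsLogConcaveDensity g → extIntegral P (logFun g) ≤ (max B L : ℝ) := by
    intro g hg
    rcases le_total (L : EReal) (extIntegral P (logFun g)) with h | h
    · have hb := hB g hg h
      rw [extIntegral_eq_sub (isConvexLsc_exponent B hg).measurable
        fun x => logFun_eq_sub_exponent (hb x)]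
      calc (B : EReal) - ((∫⁻ x, exponent B g x ∂P : ℝ≥0∞) : EReal) ≤ B - 0 :=
            EReal.sub_le_sub le_rfl (EReal.coe_ennreal_nonneg _)
        _ ≤ _ := by rw [sub_zero]; exact_mod_cast le_max_left B L
    · exact h.trans (by exact_mod_cast le_max_right B L)
  obtain ⟨S, hS⟩ : ∃ S, IsLUB {L | ∃ g, IsLogConcaveDensity g ∧ extIntegral P (logFun g) = L} S :=
    ⟨_, isLUB_sSup _⟩
  have hSle : ∀ g, IsLogConcaveDensity g → extIntegral P (logFun g) ≤ S := fun g hg =>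
    hS.1 ⟨g, hg, rfl⟩
  have hSt : S ≠ ⊤ := by
    refine ((hS.2 ?_).trans_lt (EReal.coe_lt_top (max B L))).ne
    rintro _ ⟨g, hg, rfl⟩
    exact hle g hg
  have hSb : S ≠ ⊥ := ((EReal.bot_lt_coe L).trans_le (hL.trans (hSle g₀ hg₀))).ne'
  have hSr : ((S.toReal : ℝ) : EReal) = S := EReal.coe_toReal hSt hSb
  have hex : ∀ n, ∃ g, IsLogConcaveDensity g ∧
      ((S.toReal - δ n : ℝ) : EReal) ≤ extIntegral P (logFun g) := by
    intro n
    have hlt : ((S.toReal - δ n : ℝ) : EReal) < S :=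
      lt_of_lt_of_eq (EReal.coe_lt_coe_iff.2 (sub_lt_self _ (hδ n))) hSr
    obtain ⟨_, ⟨g, hg, rfl⟩, hgL⟩ := (lt_isLUB_iff hS).1 hlt
    exact ⟨g, hg, hgL.le⟩
  choose f hf hfL using hex
  exact ⟨S.toReal, f, fun g hg => (hSle g hg).trans hSr.ge, hf, hfL⟩

theorem MemPd.exists_isProjection (hP : MemPd P) : ∃ f, IsProjection P f := by
  have := hP.isProbabilityMeasure
  -- Accuracy `4⁻ⁿ` in the objective becomes `2⁻ⁿ` in the `L²` distance of square roots. This is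
  -- summable, so the whole sequence converges almost everywhere.
  obtain ⟨M, f, hM, hf, hfM⟩ := hP.exists_maximizing_seq (δ := fun n => (1 / 4 : ℝ) ^ n)
    (fun n => by positivity)
  have hpow : ∀ N n : ℕ, N ≤ n → (1 / 4 : ℝ) ^ n ≤ (1 / 4 : ℝ) ^ N := fun N n h =>
    pow_le_pow_of_le_one (by norm_num) (by norm_num) h
  have hfM1 : ∀ n, ((M - 1 : ℝ) : EReal) ≤ extIntegral P (logFun (f n)) := fun n => by
    refine le_trans ?_ (hfM n)
    have := hpow 0 n (Nat.zero_le n)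
    simp only [pow_zero] at this
    exact_mod_cast sub_le_sub_left this M
  obtain ⟨B, hB⟩ := hP.exists_uniform_bound (M - 1)
  obtain ⟨z, ρ, ε, hρ, hε, -, hball⟩ := hP.exists_closedBall_subset
  have hfB : ∀ n x, logFun (f n) x ≤ B := fun n => hB _ (hf n) (hfM1 n)
  set u : ℕ → EuclideanSpace ℝ (Fin d) → ℝ≥0∞ := fun n => exponent B (f n) with hu_def
  have hu : ∀ n, IsConvexLsc (u n) := fun n => isConvexLsc_exponent B (hf n)
  have hs : ∀ n, ∀ x ∈ Metric.closedBall z ρ,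
      u n x ≤ ENNReal.ofReal ((2 * (B - (M - 1)) + 1) / ε) := fun n =>
    (exponent_le_on_ball hε hball (hf n) (hfB n) (hfM1 n)).2
  set s := ENNReal.ofReal ((2 * (B - (M - 1)) + 1) / ε) with hs_def
  have hκ : ∀ n, ∫⁻ x, expNeg (u n x) = ENNReal.ofReal (Real.exp (-B)) := fun n =>
    lintegral_expNeg_exponent (hf n) (hfB n)
  have hbase : ∀ v : EuclideanSpace ℝ (Fin d) → ℝ≥0∞, IsConvexLsc v →
      (∀ x ∈ Metric.closedBall z ρ, v x ≤ s) → ∫⁻ x, expNeg (v x) ≠ 0 := by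
    intro v hv hvs h0
    have h1 := (lintegral_eq_zero_iff (measurable_expNeg.comp hv.measurable)).1 h0
    have hpos : 0 < volume (Metric.closedBall z ρ) := Metric.measure_closedBall_pos _ _ hρ
    refine hpos.ne' (measure_mono_null (fun x hx => ?_) h1)
    exact (expNeg_pos ((hvs x hx).trans_lt ENNReal.ofReal_lt_top).ne).ne'
  have hJ : ∀ n, ∫⁻ x, u n x ∂P ≤ ENNReal.ofReal (B - M + (1 / 4) ^ n) := by
    intro n
    have h1 := hfM n
    rw [extIntegral_eq_sub (hu n).measurable fun x => logFun_eq_sub_exponent (hfB n x)] at h1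
    have hJt : ∫⁻ x, u n x ∂P ≠ ∞ := by
      intro h
      rw [h, EReal.coe_ennreal_top, EReal.sub_top, le_bot_iff] at h1
      exact EReal.coe_ne_bot _ h1
    rw [← EReal.coe_ennreal_toReal hJt] at h1
    norm_cast at h1
    rw [← ENNReal.ofReal_toReal hJt]
    exact ENNReal.ofReal_le_ofReal (by linarith)
  have hJ0 : ∀ n : ℕ, 0 ≤ B - M + (1 / 4 : ℝ) ^ n := by
    intro n
    have h1 := (hfM n).trans (le_of_eq (extIntegral_eq_sub (hu n).measurable
      fun x => logFun_eq_sub_exponent (hfB n x)))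
    have h2 := h1.trans (EReal.sub_le_sub (le_refl (B : EReal)) (EReal.coe_ennreal_nonneg _))
    rw [sub_zero] at h2
    norm_cast at h2
    linarith
  -- The midpoint exponent, normalised by its integral `c`, is a competitor, so `-log c - (B - M +
  -- 4⁻ᴺ) ≤ M`. Hence `c ≥ exp (-B) * exp (-4⁻ᴺ)`, and `exp t ≥ 1 + t` finishes.
  have hcomp : ∀ N n m : ℕ, N ≤ n → N ≤ m →
      ENNReal.ofReal (Real.exp (-B) * (1 - (1 / 4) ^ N)) ≤
      ∫⁻ x, expNeg (ENNReal.ofReal (1 / 2) * u n x + ENNReal.ofReal (1 / 2) * u m x) := by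
    intro N n m hn hm
    have hv := ((hu n).const_mul (1 / 2)).add ((hu m).const_mul (1 / 2))
    set c := ∫⁻ x, expNeg (ENNReal.ofReal (1 / 2) * u n x + ENNReal.ofReal (1 / 2) * u m x) with hc
    have hc0 : c ≠ 0 := by
      refine hbase _ hv fun x hx => ?_
      refine le_trans ?_ (half_add_half s).le
      gcongr
      · exact hs n x hx
      · exact hs m x hx
    have hct : c ≠ ∞ := by
      have h1 := lintegral_congr (μ := volume) (fun x => enorm_sqrtExpNeg_sub_sq (u n x) (u m x))
      have hle : c ≤ ∫⁻ x, (expNeg (u n x) + expNeg (u m x)) := by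
        rw [← h1]
        refine lintegral_mono fun x => ?_
        refine le_trans ?_ le_add_self
        rw [two_mul]
        exact le_self_add
      rw [lintegral_add_left (by exact measurable_expNeg.comp (hu n).measurable), hκ, hκ] at hle
      exact (hle.trans_lt (by finiteness)).ne
    obtain ⟨g, hg, hgL⟩ := exists_density_extIntegral_eq (P := P) hv hc0 hct
    have h1 := hM g hg
    have h2 : ∫⁻ x, (ENNReal.ofReal (1 / 2) * u n x + ENNReal.ofReal (1 / 2) * u m x) ∂P ≤
        ENNReal.ofReal (B - M + (1 / 4) ^ N) := by
      rw [lintegral_add_left ((hu n).measurable.const_mul _),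
        lintegral_const_mul _ (hu n).measurable, lintegral_const_mul _ (hu m).measurable,
        ← half_add_half (ENNReal.ofReal (B - M + (1 / 4) ^ N))]
      gcongr
      · exact (hJ n).trans (ENNReal.ofReal_le_ofReal (by linarith [hpow N n hn]))
      · exact (hJ m).trans (ENNReal.ofReal_le_ofReal (by linarith [hpow N m hm]))
    rw [hgL] at h1
    have h3 := (EReal.sub_le_sub le_rfl (EReal.coe_ennreal_le_coe_ennreal_iff.2 h2)).trans h1
    rw [EReal.coe_ennreal_ofReal, max_eq_left (hJ0 N)] at h3
    norm_cast at h3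
    have h4 : -B - (1 / 4 : ℝ) ^ N ≤ Real.log c.toReal := by rw [hc]; linarith
    rw [ENNReal.ofReal_le_iff_le_toReal hct]
    calc Real.exp (-B) * (1 - (1 / 4) ^ N) ≤ Real.exp (-B) * Real.exp (-(1 / 4) ^ N) := by
          gcongr
          linarith [Real.add_one_le_exp (-(1 / 4 : ℝ) ^ N)]
      _ = Real.exp (-B - (1 / 4) ^ N) := by rw [← Real.exp_add]; rfl
      _ ≤ Real.exp (Real.log c.toReal) := Real.exp_le_exp.2 h4
      _ = c.toReal := Real.exp_log (ENNReal.toReal_pos hc0 hct)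
  have hlim : ∀ᵐ x, ∃ l, Tendsto (fun n => u n x) atTop (𝓝 l) := by
    -- The distance estimate has constant `√2 * √(exp (-B))`; replacing `√2` by `2` provides the
    -- strict inequality that the Cauchy criterion asks for.
    set K := 2 * Real.sqrt (Real.exp (-B)) with hK
    have hK0 : 0 < K := by positivity
    have hcauchy : ∀ᵐ x, ∃ l, Tendsto (fun n => sqrtExpNeg (u n x)) atTop (𝓝 l) := by
      refine Lp.ae_tendsto_of_cauchy_eLpNorm (p := 2) (f := fun n x => sqrtExpNeg (u n x))
        (B := fun N => ENNReal.ofReal (K * (1 / 2) ^ N))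
        (fun n => (measurable_sqrtExpNeg.comp (hu n).measurable).aestronglyMeasurable)
        (by norm_num) ?_ fun N n m hn hm => ?_
      · exact (Summable.mul_left K
          (summable_geometric_of_lt_one (by norm_num) (by norm_num))).tsum_ofReal_ne_top
      · refine (eLpNorm_sqrtExpNeg_sub_le (hu n).measurable (hu m).measurable (Real.exp_pos (-B))
          (by positivity) (hκ n) (hκ m) (hcomp N n m hn hm)).trans_lt ?_
        rw [ENNReal.ofReal_lt_ofReal_iff (by positivity), Real.sqrt_lt' (by positivity), hK,
          mul_pow, mul_pow, Real.sq_sqrt (Real.exp_pos _).le, ← pow_mul, mul_comm N 2, pow_mul]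
        have : 0 < Real.exp (-B) * (1 / 4) ^ N := by positivity
        norm_num at this ⊢
        linarith
    filter_upwards [hcauchy] with x hx
    obtain ⟨l, hl⟩ := hx
    exact exists_tendsto_of_sqrtExpNeg hl
  -- The limsup supplies convexity and the hull supplies lower semicontinuity.
  set v := lscHull fun x => limsup (fun n => u n x) atTop with hv_def
  have hv : IsConvexLsc v := isConvexLsc_lscHull (isConvexENN_limsup fun n => (hu n).convex)
  have hvu : ∀ x, v x ≤ liminf (fun n => u n x) atTop :=
    lscHull_limsup_le_liminf hu hρ ENNReal.ofReal_ne_top hs hlim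
  have hvint : ∫⁻ x, expNeg (v x) ≤ ENNReal.ofReal (Real.exp (-B)) := by
    have := lintegral_expNeg_lscHull_le hu
    simp_rw [hκ] at this
    simpa using this
  have hv0 : ∫⁻ x, expNeg (v x) ≠ 0 := by
    refine hbase v hv fun x hx => (hvu x).trans ?_
    exact liminf_le_of_frequently_le (Frequently.of_forall fun n => hs n x hx)
      (by isBoundedDefault)
  have hvt : ∫⁻ x, expNeg (v x) ≠ ∞ := (hvint.trans_lt ENNReal.ofReal_lt_top).ne
  have hBM : 0 ≤ B - M := by
    have : Tendsto (fun n : ℕ => B - M + (1 / 4 : ℝ) ^ n) atTop (𝓝 (B - M + 0)) :=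
      tendsto_const_nhds.add (tendsto_pow_atTop_nhds_zero_of_lt_one (by norm_num) (by norm_num))
    rw [add_zero] at this
    exact ge_of_tendsto' this hJ0
  have hvJ : ∫⁻ x, v x ∂P ≤ ENNReal.ofReal (B - M) := by
    calc ∫⁻ x, v x ∂P ≤ ∫⁻ x, liminf (fun n => u n x) atTop ∂P := lintegral_mono hvu
      _ ≤ liminf (fun n => ∫⁻ x, u n x ∂P) atTop := lintegral_liminf_le fun n => (hu n).measurable
      _ ≤ liminf (fun n : ℕ => ENNReal.ofReal (B - M + (1 / 4) ^ n)) atTop :=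
          liminf_le_liminf (Eventually.of_forall hJ)
      _ = ENNReal.ofReal (B - M + 0) := by
          refine Tendsto.liminf_eq ?_
          refine (ENNReal.continuous_ofReal.tendsto _).comp ?_
          exact tendsto_const_nhds.add
            (tendsto_pow_atTop_nhds_zero_of_lt_one (by norm_num) (by norm_num))
      _ = _ := by rw [add_zero]
  obtain ⟨g, hg, hgL⟩ := exists_density_extIntegral_eq (P := P) hv hv0 hvt
  refine ⟨g, hg, fun g' hg' => (hM g' hg').trans ?_⟩
  rw [hgL]
  refine le_trans ?_ (EReal.sub_le_sub le_rfl (EReal.coe_ennreal_le_coe_ennreal_iff.2 hvJ))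
  rw [EReal.coe_ennreal_ofReal, max_eq_left hBM]
  norm_cast
  -- The limit may have lost Lebesgue mass, but this only helps: normalising raises the density, so
  -- the objective is still at least `B - (B - M) = M`.
  have h1 : (∫⁻ x, expNeg (v x)).toReal ≤ Real.exp (-B) :=
    ENNReal.toReal_le_of_le_ofReal (Real.exp_pos _).le hvint
  have h2 := Real.log_le_log (ENNReal.toReal_pos hv0 hvt) h1
  rw [Real.log_exp] at h2
  linarith

end

/-! ### First variation at the maximiser, and equality of means -/

section

variable {d : ℕ} {P : Measure (EuclideanSpace ℝ (Fin d))}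
  {f : EuclideanSpace ℝ (Fin d) → ℝ≥0}

lemma IsLogConcaveDensity.measurable (hf : IsLogConcaveDensity f) :
    Measurable fun x => (f x : ℝ≥0∞) :=
  hf.upperSemicontinuous.measurable.coe_nnreal_ennreal

lemma IsLogConcaveDensity.isProbabilityMeasure (hf : IsLogConcaveDensity f) :
    IsProbabilityMeasure (densityMeasure f) :=
  ⟨by rw [densityMeasure, withDensity_apply _ MeasurableSet.univ, Measure.restrict_univ,
    hf.lintegral_eq_one]⟩

lemma lintegral_expNeg_exponent_add (hf : IsLogConcaveDensity f) {B : ℝ}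
    (hB : ∀ x, logFun f x ≤ B) {G : EuclideanSpace ℝ (Fin d) → ℝ≥0∞} (hG : Measurable G) :
    ∫⁻ x, expNeg (exponent B f x + G x) =
      ENNReal.ofReal (Real.exp (-B)) * ∫⁻ x, expNeg (G x) ∂(densityMeasure f) := by
  rw [densityMeasure, lintegral_withDensity_eq_lintegral_mul _ hf.measurable
    (by exact measurable_expNeg.comp hG), ← lintegral_const_mul' _ _ (by finiteness)]
  refine lintegral_congr fun x => ?_
  simp only [Pi.mul_apply]
  rw [expNeg_add, coe_eq_of_logFun (logFun_eq_sub_exponent (hB x)), ← mul_assoc, ← mul_assoc,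
    mul_comm (ENNReal.ofReal _), exp_mul_exp_neg_eq_one, one_mul]

/-- For finite `H`, with `s = H / (n + 1)`, the inequality `1 - exp (-s) ≥ s / (1 + s)` gives the
lower bound `H / (1 + s)`, which tends to `H`. This is the difference quotient of `exp (-t H)` at `t
= 0`, in the form required by Fatou. -/
lemma le_liminf_mul_one_sub_expNeg (H : ℝ≥0∞) :
    H ≤ liminf (fun n : ℕ => ENNReal.ofReal (n + 1) *
      (1 - expNeg (ENNReal.ofReal (1 / ((n : ℝ) + 1)) * H))) atTop := by
  have hcast : Tendsto (fun n : ℕ => (n : ℝ) + 1) atTop atTop :=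
    tendsto_atTop_add_const_right _ _ tendsto_natCast_atTop_atTop
  rcases eq_or_ne H ∞ with rfl | hH
  · have h1 : ∀ n : ℕ, ENNReal.ofReal (1 / ((n : ℝ) + 1)) * ∞ = ∞ := fun n =>
      ENNReal.mul_top (by simp; positivity)
    simp_rw [h1, expNeg_top, tsub_zero, mul_one]
    exact ((ENNReal.tendsto_ofReal_nhds_top.2 hcast).liminf_eq).ge
  · lift H to ℝ≥0 using hH
    have h2 : Tendsto (fun n : ℕ => ENNReal.ofReal ((H : ℝ) / (1 + 1 / ((n : ℝ) + 1) * H))) atTop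
        (𝓝 (ENNReal.ofReal ((H : ℝ) / (1 + 0 * H)))) := by
      refine (ENNReal.continuous_ofReal.tendsto _).comp ?_
      refine tendsto_const_nhds.div (tendsto_const_nhds.add
        (tendsto_one_div_add_atTop_nhds_zero_nat.mul_const _)) (by simp)
    simp only [zero_mul, add_zero, div_one, ENNReal.ofReal_coe_nnreal] at h2
    refine h2.liminf_eq.ge.trans ?_
    refine liminf_le_liminf (Eventually.of_forall fun n => ?_)
    rw [← ENNReal.ofReal_coe_nnreal (p := H), ← ENNReal.ofReal_mul (by positivity),
      expNeg_ofReal (by positivity), ← ENNReal.ofReal_one, ← ENNReal.ofReal_sub _ (by positivity),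
      ← ENNReal.ofReal_mul (by positivity)]
    apply ENNReal.ofReal_le_ofReal
    set s := 1 / ((n : ℝ) + 1) * H with hs
    have hs0 : 0 ≤ s := by positivity
    have hH : (H : ℝ) = (n + 1) * s := by rw [hs]; field_simp
    rw [hH, mul_div_assoc]
    gcongr
    rw [div_le_iff₀ (by positivity), Real.exp_neg]
    have he := Real.add_one_le_exp s
    have hp := Real.exp_pos s
    have : (Real.exp s)⁻¹ * (1 + s) ≤ 1 := by
      rw [inv_mul_le_iff₀ hp]; linarith
    linarith

lemma lintegral_expNeg_ne_zero_iff {Ω : Type*} [MeasurableSpace Ω] {Q : Measure Ω}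
    {G : Ω → ℝ≥0∞} (hG : Measurable G) :
    ∫⁻ x, expNeg (G x) ∂Q ≠ 0 ↔ ¬ ∀ᵐ x ∂Q, G x = ∞ := by
  refine not_congr ((lintegral_eq_zero_iff (measurable_expNeg.comp hG)).trans ?_)
  exact eventually_congr (Eventually.of_forall fun x => expNeg_eq_zero)

/-- With `I = ∫ exp (-t H) dP*`, the normalised perturbation `f * exp (-t H) / I` changes the
objective by `-log I - t ∫ H dP ≤ 0`, so `1 - I ≤ -log I ≤ t ∫ H dP`. The hypothesis `hpos` says
exactly that `I ≠ 0`, so that one can normalise. -/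
theorem IsProjection.lintegral_le (hP : MemPd P) (hf : IsProjection P f)
    {H : EuclideanSpace ℝ (Fin d) → ℝ≥0∞} (hH : IsConvexLsc H)
    (hpos : ¬ ∀ᵐ x ∂(densityMeasure f), H x = ∞) :
    ∫⁻ x, H x ∂(densityMeasure f) ≤ ∫⁻ x, H x ∂P := by
  have := hP.isProbabilityMeasure
  have := hf.1.isProbabilityMeasure
  rcases eq_or_ne (∫⁻ x, H x ∂P) ∞ with hT | hT
  · rw [hT]; exact le_top
  obtain ⟨B, hB⟩ := hf.1.exists_logFun_le
  obtain ⟨L, g₀, hg₀, hL⟩ := hP.exists_extIntegral_ge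
  have hu := isConvexLsc_exponent B hf.1
  have hfL := extIntegral_eq_sub (P := P) hu.measurable fun x => logFun_eq_sub_exponent (hB x)
  have hJt : ∫⁻ x, exponent B f x ∂P ≠ ∞ := by
    intro h
    have h1 := hL.trans (hf.2 g₀ hg₀)
    rw [hfL, h, EReal.coe_ennreal_top, EReal.sub_top, le_bot_iff] at h1
    exact EReal.coe_ne_bot _ h1
  have key : ∀ t : ℝ, 0 < t →
      1 - ∫⁻ x, expNeg (ENNReal.ofReal t * H x) ∂(densityMeasure f) ≤
        ENNReal.ofReal t * ∫⁻ x, H x ∂P := by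
    intro t ht
    have hv := hu.add (hH.const_mul t)
    have hc := lintegral_expNeg_exponent_add hf.1 hB (hH.const_mul t).measurable
    set I := ∫⁻ x, expNeg (ENNReal.ofReal t * H x) ∂(densityMeasure f) with hI
    have hI0 : I ≠ 0 := by
      rw [hI, lintegral_expNeg_ne_zero_iff (hH.const_mul t).measurable]
      refine fun h => hpos (h.mono fun x hx => ?_)
      by_contra hne
      exact (ENNReal.mul_ne_top ENNReal.ofReal_ne_top hne) hx
    have hIt : I ≤ 1 := by
      refine (lintegral_mono fun x => expNeg_le_one _).trans ?_
      simp
    have hIt' : I ≠ ∞ := (hIt.trans_lt (by simp)).ne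
    have he0 : ENNReal.ofReal (Real.exp (-B)) ≠ 0 := by simp [Real.exp_pos]
    obtain ⟨g, hg, hgL⟩ := exists_density_extIntegral_eq (P := P) hv
      (by rw [hc]; exact mul_ne_zero he0 hI0) (by rw [hc]; finiteness)
    have h1 := hf.2 g hg
    rw [hgL, hfL, lintegral_add_left hu.measurable, lintegral_const_mul _ hH.measurable, hc] at h1
    have hIr : 0 < I.toReal := ENNReal.toReal_pos hI0 hIt'
    rw [ENNReal.toReal_mul, ENNReal.toReal_ofReal (Real.exp_pos _).le,
      Real.log_mul (Real.exp_pos _).ne' hIr.ne', Real.log_exp,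
      ← EReal.coe_ennreal_toReal hJt, ← EReal.coe_ennreal_toReal (by finiteness)] at h1
    norm_cast at h1
    rw [ENNReal.toReal_add hJt (by finiteness), ENNReal.toReal_mul,
      ENNReal.toReal_ofReal ht.le] at h1
    have h2 := Real.log_le_sub_one_of_pos hIr
    rw [← ENNReal.ofReal_toReal hT, ← ENNReal.ofReal_mul ht.le, ← ENNReal.ofReal_toReal hIt',
      ← ENNReal.ofReal_one, ← ENNReal.ofReal_sub _ hIr.le]
    exact ENNReal.ofReal_le_ofReal (by linarith)
  calc ∫⁻ x, H x ∂(densityMeasure f)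
      ≤ ∫⁻ x, liminf (fun n : ℕ => ENNReal.ofReal (n + 1) *
          (1 - expNeg (ENNReal.ofReal (1 / ((n : ℝ) + 1)) * H x))) atTop ∂(densityMeasure f) :=
        lintegral_mono fun x => le_liminf_mul_one_sub_expNeg (H x)
    _ ≤ liminf (fun n : ℕ => ∫⁻ x, ENNReal.ofReal (n + 1) *
          (1 - expNeg (ENNReal.ofReal (1 / ((n : ℝ) + 1)) * H x)) ∂(densityMeasure f)) atTop :=
        lintegral_liminf_le fun n => (measurable_const.sub
          (measurable_expNeg.comp (hH.const_mul _).measurable)).const_mul _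
    _ ≤ liminf (fun _ : ℕ => ∫⁻ x, H x ∂P) atTop := by
        refine liminf_le_liminf (Eventually.of_forall fun n => ?_)
        have hm : Measurable fun x => expNeg (ENNReal.ofReal (1 / ((n : ℝ) + 1)) * H x) :=
          measurable_expNeg.comp (hH.const_mul _).measurable
        have hfin : ∫⁻ x, expNeg (ENNReal.ofReal (1 / ((n : ℝ) + 1)) * H x) ∂(densityMeasure f)
            ≠ ∞ := by
          refine ((lintegral_mono fun x => expNeg_le_one _).trans_lt ?_).ne
          simp
        rw [lintegral_const_mul' _ _ (by finiteness), lintegral_sub hm hfin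
          (ae_of_all _ fun x => expNeg_le_one _), lintegral_const, measure_univ, mul_one]
        refine (mul_le_mul_right (key _ (by positivity)) _).trans (le_of_eq ?_)
        rw [← mul_assoc, ← ENNReal.ofReal_mul (by positivity), mul_one_div_cancel (by positivity),
          ENNReal.ofReal_one, one_mul]
    _ = ∫⁻ x, H x ∂P := by simp

lemma IsProjection.lintegral_le_of_ne_top (hP : MemPd P) (hf : IsProjection P f)
    {H : EuclideanSpace ℝ (Fin d) → ℝ≥0∞} (hH : IsConvexLsc H) (hfin : ∀ x, H x ≠ ∞) :
    ∫⁻ x, H x ∂(densityMeasure f) ≤ ∫⁻ x, H x ∂P := by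
  have := hf.1.isProbabilityMeasure
  refine hf.lintegral_le hP hH fun h => ?_
  obtain ⟨x, hx⟩ := h.exists
  exact hfin x hx

lemma isConvexLsc_ofReal {E : Type*} [NormedAddCommGroup E] [NormedSpace ℝ E] {φ : E → ℝ}
    (hc : Continuous φ) (hφ : ConvexOn ℝ univ φ) : IsConvexLsc fun x => ENNReal.ofReal (φ x) where
  lsc := (ENNReal.continuous_ofReal.comp hc).lowerSemicontinuous
  convex x y a b ha hb hab := by
    rw [← ENNReal.ofReal_mul ha.le, ← ENNReal.ofReal_mul hb.le]
    refine le_trans (ENNReal.ofReal_le_ofReal ?_) ENNReal.ofReal_add_le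
    exact hφ.2 (mem_univ x) (mem_univ y) ha.le hb.le hab

lemma MemPd.integrable_id (hP : MemPd P) : Integrable (fun x => x) P :=
  ⟨measurable_id.aestronglyMeasurable, hP.firstMoment⟩

lemma IsProjection.integrable_id (hP : MemPd P) (hf : IsProjection P f) :
    Integrable (fun x => x) (densityMeasure f) :=
  ⟨measurable_id.aestronglyMeasurable,
    (hf.lintegral_le_of_ne_top hP isConvexLsc_enorm fun _ => enorm_ne_top).trans_lt hP.firstMoment⟩

lemma convexOn_clm_add {E : Type*} [NormedAddCommGroup E] [NormedSpace ℝ E] (l : E →L[ℝ] ℝ)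
    (c : ℝ) : ConvexOn ℝ univ fun x => l x + c :=
  ((l : E →ₗ[ℝ] ℝ).convexOn convex_univ).add (convexOn_const c convex_univ)

lemma tendsto_integral_max_neg_sub {Ω : Type*} [MeasurableSpace Ω] {Q : Measure Ω} {φ : Ω → ℝ}
    (hφ : Integrable φ Q) :
    Tendsto (fun n : ℕ => ∫ x, max (-(φ x + n)) 0 ∂Q) atTop (𝓝 0) := by
  have h := tendsto_integral_of_dominated_convergence (μ := Q)
    (F := fun (n : ℕ) x => max (-(φ x + n)) 0) (f := fun _ => 0) (fun x => ‖φ x‖)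
    (fun n => ((hφ.aestronglyMeasurable.add aestronglyMeasurable_const).neg).sup
      aestronglyMeasurable_const) hφ.norm ?_ ?_
  · simpa using h
  · refine fun n => ae_of_all _ fun x => ?_
    rw [Real.norm_of_nonneg (le_max_right _ _)]
    have : (0 : ℝ) ≤ n := n.cast_nonneg
    refine max_le ?_ (norm_nonneg _)
    have := neg_abs_le (φ x)
    rw [Real.norm_eq_abs]
    linarith
  · refine ae_of_all _ fun x => tendsto_const_nhds.congr' ?_
    filter_upwards [eventually_ge_atTop ⌈-φ x⌉₊] with n hn
    have h1 : -φ x ≤ n := (Nat.le_ceil _).trans (by exact_mod_cast hn)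
    rw [max_eq_right]
    linarith

/-- The available test functions are non-negative, so `l` is replaced by `(l + n)⁺`. Under `P*` this
only increases the integral; under `P` the excess is `∫ (l + n)⁻`, which vanishes as `n → ∞`. -/
lemma IsProjection.integral_clm_le (hP : MemPd P) (hf : IsProjection P f)
    (l : EuclideanSpace ℝ (Fin d) →L[ℝ] ℝ) :
    ∫ x, l x ∂(densityMeasure f) ≤ ∫ x, l x ∂P := by
  have := hP.isProbabilityMeasure
  have := hf.1.isProbabilityMeasure
  have hi1 : Integrable (fun x => l x) (densityMeasure f) :=
    l.integrable_comp (hf.integrable_id hP)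
  have hi2 : Integrable (fun x => l x) P := l.integrable_comp hP.integrable_id
  have key : ∀ n : ℕ, ∫ x, l x ∂(densityMeasure f) ≤
      ∫ x, l x ∂P + ∫ x, max (-(l x + n)) 0 ∂P := by
    intro n
    have hj1 : Integrable (fun x => l x + n) (densityMeasure f) := hi1.add (integrable_const _)
    have hj2 : Integrable (fun x => l x + n) P := hi2.add (integrable_const _)
    have h1 := hf.lintegral_le_of_ne_top hP
      (isConvexLsc_ofReal (by fun_prop) (convexOn_clm_add l n)) (fun x => ENNReal.ofReal_ne_top)
    have h2 := ENNReal.toReal_mono hj2.lintegral_lt_top.ne h1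
    have h3 := integral_eq_lintegral_pos_part_sub_lintegral_neg_part hj1
    have h4 : ∫ x, (l x + n) ∂P + ∫ x, max (-(l x + n)) 0 ∂P =
        (∫⁻ x, ENNReal.ofReal (l x + n) ∂P).toReal := by
      rw [← integral_add hj2 hj2.neg_part, integral_eq_lintegral_of_nonneg_ae]
      · congr 1
        refine lintegral_congr fun x => ?_
        rcases le_total 0 (l x + n) with h | h
        · rw [max_eq_right (by linarith), add_zero]
        · rw [max_eq_left (by linarith), add_neg_cancel, ENNReal.ofReal_of_nonpos h]; simp
      · refine ae_of_all _ fun x => ?_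
        have := le_max_left (-(l x + n)) 0
        simp only [Pi.zero_apply]
        linarith
      · exact (hj2.add hj2.neg_part).aestronglyMeasurable
    have h5 : 0 ≤ (∫⁻ x, ENNReal.ofReal (-(l x + n)) ∂(densityMeasure f)).toReal :=
      ENNReal.toReal_nonneg
    rw [integral_add hi1 (integrable_const _)] at h3
    rw [integral_add hi2 (integrable_const _)] at h4
    simp only [integral_const, probReal_univ, one_smul] at h3 h4
    linarith
  have ht := (tendsto_integral_max_neg_sub hi2).const_add (∫ x, l x ∂P)
  rw [add_zero] at ht
  exact ge_of_tendsto' ht key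

lemma IsProjection.integral_clm_eq (hP : MemPd P) (hf : IsProjection P f)
    (l : EuclideanSpace ℝ (Fin d) →L[ℝ] ℝ) :
    ∫ x, l x ∂(densityMeasure f) = ∫ x, l x ∂P := by
  refine le_antisymm (hf.integral_clm_le hP l) ?_
  have h := hf.integral_clm_le hP (-l)
  simp only [neg_apply, integral_neg] at h
  linarith

lemma IsProjection.integral_id_eq (hP : MemPd P) (hf : IsProjection P f) :
    ∫ x, x ∂(densityMeasure f) = ∫ x, x ∂P := by
  refine ext_inner_left ℝ fun v => ?_
  have h := hf.integral_clm_eq hP (innerSL ℝ v)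
  rw [(innerSL ℝ v).integral_comp_comm (hf.integrable_id hP),
    (innerSL ℝ v).integral_comp_comm hP.integrable_id] at h
  simpa using h

end

/-! ### Affine minorants of extended convex functions, and extended integrals -/

section

section Subgradient

variable {V : Type*} [NormedAddCommGroup V] [NormedSpace ℝ V] {h : V → EReal}

lemma IsExtConvex.convexOn_toReal (hh : IsExtConvex h) :
    ConvexOn ℝ {x | h x < ⊤} fun x => (h x).toReal := by
  have key : ∀ x, h x < ⊤ → ∀ y, h y < ⊤ → ∀ a b : ℝ, 0 < a → 0 < b → a + b = 1 →
      h (a • x + b • y) ≤ ((a * (h x).toReal + b * (h y).toReal : ℝ) : EReal) := by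
    intro x hx y hy a b ha hb hab
    refine (hh.2 x y a b ha hb hab).trans (le_of_eq ?_)
    rw [EReal.coe_add, EReal.coe_mul, EReal.coe_mul, EReal.coe_toReal hx.ne (hh.1 x),
      EReal.coe_toReal hy.ne (hh.1 y)]
  rw [convexOn_iff_forall_pos]
  refine ⟨?_, fun x hx y hy a b ha hb hab => ?_⟩
  · rw [convex_iff_forall_pos]
    intro x hx y hy a b ha hb hab
    exact (key x hx y hy a b ha hb hab).trans_lt (EReal.coe_lt_top _)
  · have h1 := key x hx y hy a b ha hb hab
    have h2 := EReal.toReal_le_toReal h1 (hh.1 _) (EReal.coe_ne_top _)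
    rwa [EReal.toReal_coe] at h2

lemma IsExtConvex.convex_lt_top (hh : IsExtConvex h) : Convex ℝ {x | h x < ⊤} :=
  hh.convexOn_toReal.1

/-- Separate `(x₀, h x₀)` from the open strict epigraph over the interior of the domain. Points
above `x₀` force the vertical component of the functional to be negative, and dividing by it yields
the slope. -/
lemma IsExtConvex.exists_subgradient [FiniteDimensional ℝ V] (hh : IsExtConvex h) {x₀ : V}
    (hx₀ : x₀ ∈ interior {x | h x < ⊤}) :
    ∃ l : V →L[ℝ] ℝ, ∀ x, (((h x₀).toReal + l (x - x₀) : ℝ) : EReal) ≤ h x := by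
  set D := {x | h x < ⊤} with hD
  set g : V → ℝ := fun x => (h x).toReal with hg
  have hgc : ConvexOn ℝ D g := hh.convexOn_toReal
  have hgi : ConvexOn ℝ (interior D) g := hgc.subset interior_subset hgc.1.interior
  have hcont : ContinuousOn g (interior D) := hgc.continuousOn_interior
  set S : Set (V × ℝ) := {p | p.1 ∈ interior D ∧ g p.1 < p.2} with hS
  have hSo : IsOpen S := by
    rw [isOpen_iff_mem_nhds]
    rintro ⟨x, t⟩ ⟨hx, ht⟩
    have hgx : ContinuousAt g x := hcont.continuousAt (isOpen_interior.mem_nhds hx)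
    have h1 : ∀ᶠ p : V × ℝ in 𝓝 (x, t), p.1 ∈ interior D :=
      continuousAt_fst.eventually (isOpen_interior.mem_nhds hx)
    have h2 : ∀ᶠ p : V × ℝ in 𝓝 (x, t), g p.1 < p.2 :=
      (ContinuousAt.comp (f := Prod.fst) (x := (x, t)) hgx continuousAt_fst).eventually_lt
        continuousAt_snd ht
    filter_upwards [h1, h2] with p hp1 hp2 using ⟨hp1, hp2⟩
  obtain ⟨F, hF⟩ := geometric_hahn_banach_open_point hgi.convex_strict_epigraph hSo
    (x := (x₀, g x₀)) (fun hmem => lt_irrefl _ hmem.2)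
  have hsplit : ∀ x t, F (x, t) = F (x, 0) + t * F (0, 1) := fun x t => by
    rw [← smul_eq_mul, ← map_smul, ← map_add]; simp
  have hneg : F (0, 1) < 0 := by
    have h1 := hF (x₀, g x₀ + 1) ⟨hx₀, by simp⟩
    rw [hsplit, hsplit x₀ (g x₀)] at h1
    linarith
  set c := F (0, 1) with hc
  set l : V →L[ℝ] ℝ := (-c)⁻¹ • F.comp (ContinuousLinearMap.inl ℝ V ℝ) with hl
  have hlx : ∀ x, l x = (-c)⁻¹ * F (x, 0) := fun x => by simp [hl]
  have hInt : ∀ x ∈ interior D, g x₀ + l (x - x₀) ≤ g x := by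
    intro x hx
    have hlim : ∀ t, g x < t → g x₀ + l (x - x₀) ≤ t := by
      intro t ht
      have h1 := hF (x, t) ⟨hx, ht⟩
      rw [hsplit, hsplit x₀ (g x₀)] at h1
      rw [map_sub, hlx, hlx, ← mul_sub, inv_mul_eq_div, ← le_sub_iff_add_le',
        div_le_iff₀ (by linarith)]
      nlinarith
    exact le_of_forall_gt_imp_ge_of_dense hlim
  refine ⟨l, fun x => ?_⟩
  by_cases hx : x ∈ D
  -- For a boundary point of the domain, the midpoint with `x₀` is interior; the inequality there
  -- and convexity give it at `x`.
  · have hmid : (1 / 2 : ℝ) • x₀ + (1 / 2 : ℝ) • x ∈ interior D :=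
      hgc.1.combo_interior_self_mem_interior hx₀ hx (by norm_num) (by norm_num) (by norm_num)
    have h1 := hInt _ hmid
    have h2 : g ((1 / 2 : ℝ) • x₀ + (1 / 2 : ℝ) • x) ≤ (1 / 2 : ℝ) • g x₀ + (1 / 2 : ℝ) • g x :=
      hgc.2 (interior_subset hx₀) hx (by norm_num) (by norm_num) (by norm_num)
    have h3 : (1 / 2 : ℝ) • x₀ + (1 / 2 : ℝ) • x - x₀ = (1 / 2 : ℝ) • (x - x₀) := by module
    rw [h3, map_smul] at h1
    simp only [smul_eq_mul] at h1 h2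
    have h4 : g x₀ + l (x - x₀) ≤ g x := by linarith
    rw [← EReal.coe_toReal (LT.lt.ne hx) (hh.1 x)]
    exact_mod_cast h4
  · have : h x = ⊤ := by
      by_contra hne
      exact hx (lt_top_iff_ne_top.2 hne)
    rw [this]; exact le_top

/-- The domain may have empty interior. Translated to the origin it has interior in its linear span,
where a subgradient exists; the orthogonal projection extends this to the whole space, and outside
the domain nothing is required. -/
lemma IsExtConvex.exists_affine_le {F : Type*} [NormedAddCommGroup F] [InnerProductSpace ℝ F]
    [FiniteDimensional ℝ F] {h : F → EReal} (hh : IsExtConvex h) :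
    ∃ (l : F →L[ℝ] ℝ) (c : ℝ), ∀ x, ((l x + c : ℝ) : EReal) ≤ h x := by
  by_cases hD : {x | h x < ⊤}.Nonempty
  swap
  · refine ⟨0, 0, fun x => ?_⟩
    have : h x = ⊤ := by
      by_contra hne
      exact hD ⟨x, lt_top_iff_ne_top.2 hne⟩
    rw [this]; exact le_top
  obtain ⟨x₀, hx₀⟩ := hD
  set S : Set F := (fun w => x₀ + w) ⁻¹' {x | h x < ⊤} with hS
  set W := Submodule.span ℝ S with hW
  set h' : W → EReal := fun w => h (x₀ + w) with hh'
  have hc' : IsExtConvex h' := by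
    refine ⟨fun w => hh.1 _, fun x y a b ha hb hab => ?_⟩
    have h1 := hh.2 (x₀ + x) (x₀ + y) a b ha hb hab
    have h2 : a • (x₀ + (x : F)) + b • (x₀ + (y : F)) = x₀ + ((a • x + b • y : W) : F) := by
      have : x₀ = (a + b) • x₀ := by rw [hab, one_smul]
      push_cast
      nth_rw 3 [this]
      module
    rw [h2] at h1
    exact h1
  have h0 : (0 : W) ∈ {w | h' w < ⊤} := by simpa [hh'] using hx₀
  have hne : (interior {w | h' w < ⊤}).Nonempty := by
    rw [hc'.convex_lt_top.interior_nonempty_iff_affineSpan_eq_top,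
      AffineSubspace.affineSpan_eq_top_iff_vectorSpan_eq_top_of_nonempty ℝ _ _ ⟨0, h0⟩, eq_top_iff,
      ← Submodule.span_span_coe_preimage (R := ℝ) (s := S), Submodule.span_le]
    intro w hw
    have := vsub_mem_vectorSpan ℝ (show w ∈ {w | h' w < ⊤} from hw) h0
    simpa using this
  obtain ⟨w₀, hw₀⟩ := hne
  obtain ⟨l, hl⟩ := hc'.exists_subgradient hw₀
  refine ⟨l.comp W.orthogonalProjectionOnto,
    (h' w₀).toReal - l w₀ - l (W.orthogonalProjectionOnto x₀), fun x => ?_⟩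
  by_cases hx : h x < ⊤
  · have hxW : x - x₀ ∈ W := Submodule.subset_span (by simpa [hS] using hx)
    have h1 := hl ⟨x - x₀, hxW⟩
    simp only [hh', add_sub_cancel] at h1
    refine le_trans (le_of_eq ?_) h1
    congr 1
    have h2 : W.orthogonalProjectionOnto (x - x₀) = ⟨x - x₀, hxW⟩ :=
      Submodule.orthogonalProjectionOnto_mem_subspace_eq_self (⟨x - x₀, hxW⟩ : W)
    rw [map_sub l, ← h2, map_sub, map_sub, ContinuousLinearMap.comp_apply]
    ring
  · rw [not_lt_top_iff.1 hx]; exact le_top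

end Subgradient

section ExtIntegral

variable {Ω : Type*} [MeasurableSpace Ω] {Q : Measure Ω}

lemma extIntegral_mono {g h : Ω → EReal} (hgh : ∀ x, g x ≤ h x) :
    extIntegral Q g ≤ extIntegral Q h := by
  refine EReal.sub_le_sub ?_ ?_ <;> rw [EReal.coe_ennreal_le_coe_ennreal_iff]
  · exact lintegral_mono fun x => EReal.toENNReal_le_toENNReal (hgh x)
  · exact lintegral_mono fun x => EReal.toENNReal_le_toENNReal (EReal.neg_le_neg_iff.2 (hgh x))

lemma extIntegral_congr_ae {g h : Ω → EReal} (hgh : g =ᵐ[Q] h) :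
    extIntegral Q g = extIntegral Q h := by
  have h1 : ∫⁻ x, (g x).toENNReal ∂Q = ∫⁻ x, (h x).toENNReal ∂Q :=
    lintegral_congr_ae (hgh.mono fun x hx => congrArg EReal.toENNReal hx)
  have h2 : ∫⁻ x, (-g x).toENNReal ∂Q = ∫⁻ x, (-h x).toENNReal ∂Q :=
    lintegral_congr_ae (hgh.mono fun x hx => congrArg (fun t => (-t).toENNReal) hx)
  rw [extIntegral, extIntegral, h1, h2]

/-- Writing `g = a + H`, one integrates `g⁺ + a⁻ = g⁻ + (a⁺ + H)`. The terms `a⁺`, `a⁻` and `g⁻ ≤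
a⁻` have finite integral, so only `g⁺` and `H` can be infinite, and they are so together. -/
lemma extIntegral_add_eq {a : Ω → ℝ} (ha : Integrable a Q) (ham : Measurable a) {H : Ω → ℝ≥0∞}
    (hH : Measurable H) :
    extIntegral Q (fun x => (a x : EReal) + H x) =
      ((∫ x, a x ∂Q : ℝ) : EReal) + ((∫⁻ x, H x ∂Q : ℝ≥0∞) : EReal) := by
  set g : Ω → EReal := fun x => (a x : EReal) + H x with hg
  have hgm : Measurable g := ham.coe_real_ereal.add hH.coe_ereal_ennreal
  have hpt : ∀ x, (g x).toENNReal + ENNReal.ofReal (-a x) =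
      (-g x).toENNReal + (ENNReal.ofReal (a x) + H x) := by
    intro x
    simp only [hg]
    rcases eq_or_ne (H x) ∞ with hx | hx
    · simp [hx]
    · lift H x to ℝ≥0 using hx with p
      have e (s : ℝ≥0) : ((s : ℝ≥0∞) : EReal) = ((s : ℝ) : EReal) := rfl
      rw [e, ← EReal.coe_add, ← EReal.coe_neg, EReal.real_coe_toENNReal, EReal.real_coe_toENNReal,
        ← ENNReal.ofReal_coe_nnreal (p := p)]
      have hp := p.coe_nonneg
      rcases le_total 0 (a x) with h1 | h1
      · rw [ENNReal.ofReal_of_nonpos (p := -a x) (by linarith),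
          ENNReal.ofReal_of_nonpos (p := -(a x + p)) (by linarith), ENNReal.ofReal_add h1 hp]
        simp
      · rw [ENNReal.ofReal_of_nonpos (p := a x) h1, zero_add]
        rcases le_total 0 (a x + p) with h2 | h2
        · rw [ENNReal.ofReal_of_nonpos (p := -(a x + p)) (by linarith), zero_add,
            ← ENNReal.ofReal_add h2 (by linarith)]
          congr 1; ring
        · rw [ENNReal.ofReal_of_nonpos (p := a x + p) h2, zero_add,
            ← ENNReal.ofReal_add (by linarith) hp]
          congr 1; ring
  have hInt := lintegral_congr (μ := Q) hpt
  rw [lintegral_add_left hgm.ereal_toENNReal, lintegral_add_left (by exact hgm.neg.ereal_toENNReal),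
    lintegral_add_right _ hH] at hInt
  have hneg : ∫⁻ x, (-g x).toENNReal ∂Q ≤ ∫⁻ x, ENNReal.ofReal (-a x) ∂Q := by
    refine lintegral_mono fun x => ?_
    rw [← EReal.real_coe_toENNReal]
    refine EReal.toENNReal_le_toENNReal ?_
    rw [EReal.coe_neg, EReal.neg_le_neg_iff]
    exact le_add_of_nonneg_right (EReal.coe_ennreal_nonneg _)
  have hat : ∫⁻ x, ENNReal.ofReal (-a x) ∂Q ≠ ∞ := ha.neg.lintegral_lt_top.ne
  have hat' : ∫⁻ x, ENNReal.ofReal (a x) ∂Q ≠ ∞ := ha.lintegral_lt_top.ne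
  rw [integral_eq_lintegral_pos_part_sub_lintegral_neg_part ha, extIntegral]
  have hqt := (hneg.trans_lt hat.lt_top).ne
  generalize ∫⁻ x, (g x).toENNReal ∂Q = p at *
  generalize ∫⁻ x, (-g x).toENNReal ∂Q = q at *
  generalize ∫⁻ x, H x ∂Q = r at *
  generalize ∫⁻ x, ENNReal.ofReal (a x) ∂Q = s at *
  generalize ∫⁻ x, ENNReal.ofReal (-a x) ∂Q = t at *
  lift q to ℝ≥0 using hqt
  lift s to ℝ≥0 using hat'
  lift t to ℝ≥0 using hat
  rcases eq_or_ne r ∞ with rfl | hr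
  · have : p = ∞ := by
      by_contra hp
      have : p + t ≠ ∞ := by finiteness
      exact this (by simpa using hInt)
    subst this
    rw [EReal.coe_ennreal_top, EReal.top_sub (by simp), EReal.coe_add_top]
  · lift r to ℝ≥0 using hr
    have hp : p ≠ ∞ := by
      rintro rfl
      have : (q : ℝ≥0∞) + (s + r) ≠ ∞ := by finiteness
      exact this (by simpa using hInt.symm)
    lift p to ℝ≥0 using hp
    have h2 : (p : ℝ) + t = q + (s + r) := by exact_mod_cast hInt
    have e (s : ℝ≥0) : ((s : ℝ≥0∞) : EReal) = ((s : ℝ) : EReal) := rfl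
    rw [e, e, e, ENNReal.coe_toReal, ENNReal.coe_toReal]
    norm_cast
    linarith

lemma extIntegral_eq_top [IsProbabilityMeasure Q] {h : Ω → EReal}
    (hneg : ∫⁻ x, (-h x).toENNReal ∂Q < ∞) {N : Set Ω} (hN : MeasurableSet N)
    (hsub : {x | h x < ⊤} ⊆ N) (hQN : Q N < 1) : extIntegral Q h = ⊤ := by
  have h1 : ∫⁻ x, (h x).toENNReal ∂Q = ∞ := by
    rw [eq_top_iff]
    have h2 : ∫⁻ x, Nᶜ.indicator (fun _ => ∞) x ∂Q = ∞ := by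
      rw [lintegral_indicator_const hN.compl, ENNReal.top_mul]
      rw [Ne, prob_compl_eq_zero_iff hN]
      exact hQN.ne
    rw [← h2]
    refine lintegral_mono fun x => ?_
    by_cases hx : x ∈ N
    · simp [hx]
    · have : h x = ⊤ := by
        by_contra hne
        exact hx (hsub (lt_top_iff_ne_top.2 hne))
      simp [this]
  rw [extIntegral, h1, EReal.coe_ennreal_top, EReal.top_sub]
  simpa using hneg.ne

end ExtIntegral

end

/-! ### Convex ordering for arbitrary convex functions -/

section

variable {d : ℕ} {P : Measure (EuclideanSpace ℝ (Fin d))}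
  {f : EuclideanSpace ℝ (Fin d) → ℝ≥0}

section ConvexOrder

lemma isConvexLsc_iSup {E ι : Type*} [NormedAddCommGroup E] [NormedSpace ℝ E]
    {u : ι → E → ℝ≥0∞} (hu : ∀ i, IsConvexLsc (u i)) : IsConvexLsc fun x => ⨆ i, u i x where
  lsc := lowerSemicontinuous_iSup fun i => (hu i).lsc
  convex x y a b ha hb hab := iSup_le fun i => ((hu i).convex x y a b ha hb hab).trans <| by
    gcongr
    · exact le_iSup (fun i => u i x) i
    · exact le_iSup (fun i => u i y) i

lemma isConvexLsc_infEDist {E : Type*} [NormedAddCommGroup E] [NormedSpace ℝ E] {C : Set E}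
    (hC : Convex ℝ C) : IsConvexLsc fun x => Metric.infEDist x C where
  lsc := Metric.continuous_infEDist.lowerSemicontinuous
  convex := by
    refine isConvexENN_of_forall_lt fun x y a b ha hb hab p q hp hq => ?_
    obtain ⟨x', hx', hp'⟩ := Metric.infEDist_lt_iff.1 hp
    obtain ⟨y', hy', hq'⟩ := Metric.infEDist_lt_iff.1 hq
    refine (Metric.infEDist_le_edist_of_mem (hC hx' hy' ha.le hb.le hab)).trans ?_
    refine (edist_add_add_le _ _ _ _).trans ?_
    rw [edist_smul₀, edist_smul₀, ENNReal.smul_def, ENNReal.smul_def, smul_eq_mul, smul_eq_mul]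
    have e : ∀ {r : ℝ}, 0 < r → ((‖r‖₊ : ℝ≥0) : ℝ≥0∞) = ENNReal.ofReal r := fun {r} hr => by
      rw [← enorm_eq_nnnorm, Real.enorm_of_nonneg hr.le]
    rw [e ha, e hb]
    gcongr

lemma IsExtConvex.lintegral_neg_lt_top {Q : Measure (EuclideanSpace ℝ (Fin d))} [IsFiniteMeasure Q]
    (hQ : Integrable (fun x => x) Q) {h : EuclideanSpace ℝ (Fin d) → EReal} (hh : IsExtConvex h) :
    ∫⁻ x, (-h x).toENNReal ∂Q < ∞ := by
  obtain ⟨l, c, hlc⟩ := hh.exists_affine_le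
  have hInt : Integrable (fun x => -(l x + c)) Q :=
    ((l.integrable_comp hQ).add (integrable_const c)).neg
  refine lt_of_le_of_lt (lintegral_mono fun x => ?_) hInt.lintegral_lt_top
  rw [← EReal.real_coe_toENNReal]
  refine EReal.toENNReal_le_toENNReal ?_
  rw [EReal.coe_neg, EReal.neg_le_neg_iff]
  exact hlc x

/-- The distance to `D` is a finite convex test function with zero integral under `P`, hence also
under `P*`. -/
lemma IsProjection.ae_mem_closure (hP : MemPd P) (hf : IsProjection P f)
    {D : Set (EuclideanSpace ℝ (Fin d))} (hD : Convex ℝ D) (hne : D.Nonempty)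
    (hPD : P (closure D) = 1) : ∀ᵐ x ∂(densityMeasure f), x ∈ closure D := by
  have := hP.isProbabilityMeasure
  have hu := isConvexLsc_infEDist hD
  have h1 := hf.lintegral_le_of_ne_top hP hu fun x => Metric.infEDist_ne_top hne
  have h2 : ∫⁻ x, Metric.infEDist x D ∂P = 0 := by
    rw [lintegral_eq_zero_iff hu.measurable]
    have h3 : ∀ᵐ x ∂P, x ∈ closure D :=
      (prob_compl_eq_zero_iff isClosed_closure.measurableSet).2 hPD
    filter_upwards [h3] with x hx
    exact Metric.mem_closure_iff_infEDist_zero.1 hx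
  rw [h2, nonpos_iff_eq_zero, lintegral_eq_zero_iff hu.measurable] at h1
  filter_upwards [h1] with x hx
  exact Metric.mem_closure_iff_infEDist_zero.2 hx

lemma densityMeasure_absolutelyContinuous (f : EuclideanSpace ℝ (Fin d) → ℝ≥0) :
    densityMeasure f ≪ volume := withDensity_absolutelyContinuous _ _

theorem IsProjection.extIntegral_le (hP : MemPd P) (hf : IsProjection P f)
    {h : EuclideanSpace ℝ (Fin d) → EReal} (hh : IsExtConvex h) :
    extIntegral (densityMeasure f) h ≤ extIntegral P h := by
  have := hP.isProbabilityMeasure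
  have := hf.1.isProbabilityMeasure
  have hneg := hh.lintegral_neg_lt_top hP.integrable_id
  set D := {x | h x < ⊤} with hD_def
  have hD : Convex ℝ D := hh.convex_lt_top
  -- If the domain of `h` has empty interior it lies in a hyperplane (or is empty); if its closure
  -- has mass below one, it misses mass as well. In both cases `h = ∞` on a set of positive `P`-mass
  -- and the right-hand side is `∞`.
  rcases (interior D).eq_empty_or_nonempty with hInt | ⟨x₀, hx₀⟩
  · suffices hN : ∃ N, MeasurableSet N ∧ D ⊆ N ∧ P N < 1 by
      obtain ⟨N, hN, hDN, hPN⟩ := hN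
      rw [extIntegral_eq_top hneg hN hDN hPN]
      exact le_top
    rcases D.eq_empty_or_nonempty with hDe | hDne
    · exact ⟨∅, MeasurableSet.empty, hDe.subset, by simp⟩
    have hspan : affineSpan ℝ D ≠ ⊤ := by
      rw [Ne, ← hD.interior_nonempty_iff_affineSpan_eq_top, hInt]
      simp
    obtain ⟨v, hv, c, hc⟩ := exists_hyperplane_of_affineSpan_ne_top hDne hspan
    exact ⟨_, (isClosed_eq (continuous_const.inner continuous_id)
      continuous_const).measurableSet, hc, hP.hyperplane v hv c⟩
  rcases lt_or_eq_of_le (prob_le_one (μ := P) (s := closure D)) with hcl | hcl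
  · rw [extIntegral_eq_top hneg isClosed_closure.measurableSet subset_closure hcl]
    exact le_top
  have hae : ∀ᵐ x ∂(densityMeasure f), x ∈ interior D := by
    filter_upwards [hf.ae_mem_closure hP hD ⟨x₀, interior_subset hx₀⟩ hcl,
      (densityMeasure_absolutelyContinuous f).ae_le
        (measure_eq_zero_iff_ae_notMem.1 (hD.addHaar_frontier volume))] with x hx1 hx2
    by_contra hx
    exact hx2 ⟨hx1, hx⟩
  have hsub : ∀ y : interior D, ∃ l : EuclideanSpace ℝ (Fin d) →L[ℝ] ℝ,
      ∀ x, (((h y).toReal + l (x - y) : ℝ) : EReal) ≤ h x := fun y => hh.exists_subgradient y.2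
  choose l hl using hsub
  set y₀ : interior D := ⟨x₀, hx₀⟩ with hy₀
  set a : EuclideanSpace ℝ (Fin d) → ℝ := fun x => (h y₀).toReal + l y₀ (x - y₀) with ha
  -- The supremum of all supporting affine functions at interior points, relative to the one at
  -- `x₀`. It is lower semicontinuous, equals `h - a` on the interior, which carries `P*`, and
  -- satisfies `a + H ≤ h` everywhere. So no regularity of `h` on the boundary of its domain is
  -- needed.
  set H : EuclideanSpace ℝ (Fin d) → ℝ≥0∞ := fun x =>
    ⨆ y : interior D, ENNReal.ofReal ((h y).toReal + l y (x - y) - a x) with hH_def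
  have hH : IsConvexLsc H := by
    refine isConvexLsc_iSup fun y => isConvexLsc_ofReal (by fun_prop) ?_
    have heq : (fun x => (h y).toReal + l y (x - y) - a x) = fun x => (l y - l y₀) x +
        ((h y).toReal - l y y - (h y₀).toReal + l y₀ y₀) := by
      ext x
      simp only [ha, map_sub, sub_apply]
      ring
    rw [heq]
    exact convexOn_clm_add _ _
  have haH : ∀ x, (a x : EReal) + H x ≤ h x := by
    intro x
    by_cases hx : h x < ⊤
    · have hr : h x = ((h x).toReal : EReal) := (EReal.coe_toReal hx.ne (hh.1 x)).symm
      have h1 : ∀ y : interior D, (h y).toReal + l y (x - y) ≤ (h x).toReal := fun y => by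
        have := hl y x
        rw [hr] at this
        exact_mod_cast this
      have h2 : H x ≤ ENNReal.ofReal ((h x).toReal - a x) :=
        iSup_le fun y => ENNReal.ofReal_le_ofReal (by linarith [h1 y])
      have h3 : 0 ≤ (h x).toReal - a x := sub_nonneg.2 (h1 y₀)
      calc (a x : EReal) + H x ≤ a x + ((ENNReal.ofReal ((h x).toReal - a x) : ℝ≥0∞) : EReal) := by
            gcongr
            exact_mod_cast h2
        _ = h x := by
            rw [EReal.coe_ennreal_ofReal, max_eq_left h3, ← EReal.coe_add, add_sub_cancel, ← hr]
    · rw [not_lt_top_iff.1 hx]; exact le_top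
  have hlt : ∀ x ∈ interior D, h x < ⊤ := fun x hx =>
    show x ∈ D from interior_subset hx
  have haH' : ∀ x ∈ interior D, h x = (a x : EReal) + H x := by
    intro x hx
    refine le_antisymm ?_ (haH x)
    have hr : h x = ((h x).toReal : EReal) :=
      (EReal.coe_toReal (hlt x hx).ne (hh.1 x)).symm
    have h1 : ENNReal.ofReal ((h x).toReal - a x) ≤ H x := by
      refine le_trans (le_of_eq ?_) (le_iSup (fun y : interior D =>
        ENNReal.ofReal ((h y).toReal + l y (x - y) - a x)) ⟨x, hx⟩)
      simp
    calc h x = (a x : EReal) + (((h x).toReal - a x : ℝ) : EReal) := by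
          rw [← EReal.coe_add, add_sub_cancel, ← hr]
      _ ≤ (a x : EReal) + ((ENNReal.ofReal ((h x).toReal - a x) : ℝ≥0∞) : EReal) := by
          gcongr
          rw [EReal.coe_ennreal_ofReal]
          exact_mod_cast le_max_left _ _
      _ ≤ _ := by
          gcongr
          exact_mod_cast h1
  have hfin : ¬ ∀ᵐ x ∂(densityMeasure f), H x = ∞ := by
    intro hcon
    obtain ⟨x, hx1, hx2⟩ := (hae.and hcon).exists
    have h1 := haH' x hx1
    rw [hx2, EReal.coe_ennreal_top, EReal.coe_add_top] at h1
    exact (hlt x hx1).ne h1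
  have hle := hf.lintegral_le hP hH hfin
  have ham : Measurable a := by
    have : Continuous a := by fun_prop
    exact this.measurable
  have haeq : a = fun x => l y₀ x + ((h y₀).toReal - l y₀ y₀) := by
    ext x
    simp only [ha, map_sub]
    ring
  have hi1 : Integrable (fun x => l y₀ x) (densityMeasure f) :=
    (l y₀).integrable_comp (hf.integrable_id hP)
  have hi2 : Integrable (fun x => l y₀ x) P := (l y₀).integrable_comp hP.integrable_id
  have ha1 : Integrable a (densityMeasure f) := by
    rw [haeq]; exact hi1.add (integrable_const _)
  have ha2 : Integrable a P := by rw [haeq]; exact hi2.add (integrable_const _)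
  have hmean : ∫ x, a x ∂(densityMeasure f) = ∫ x, a x ∂P := by
    rw [haeq, integral_add hi1 (integrable_const _), integral_add hi2 (integrable_const _),
      hf.integral_clm_eq hP]
    simp
  calc extIntegral (densityMeasure f) h
      = extIntegral (densityMeasure f) fun x => (a x : EReal) + H x :=
        extIntegral_congr_ae (hae.mono haH')
    _ = ((∫ x, a x ∂(densityMeasure f) : ℝ) : EReal) +
          ((∫⁻ x, H x ∂(densityMeasure f) : ℝ≥0∞) : EReal) :=
        extIntegral_add_eq ha1 ham hH.measurable
    _ ≤ ((∫ x, a x ∂P : ℝ) : EReal) + ((∫⁻ x, H x ∂P : ℝ≥0∞) : EReal) := by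
        rw [hmean]
        gcongr
        exact_mod_cast hle
    _ = extIntegral P fun x => (a x : EReal) + H x :=
        (extIntegral_add_eq ha2 ham hH.measurable).symm
    _ ≤ extIntegral P h := extIntegral_mono haH

end ConvexOrder

/-! ### Exponential tails of log-concave densities -/

section Tail

/-- If `u` were below `s + 1` at a distant `x`, it would be at most `s + 1` on a long tube from `z`
towards `x`. The tube contains `n` disjoint balls, too many for the integral of `exp (-u)`. -/
lemma IsConvexLsc.exists_radius {u : EuclideanSpace ℝ (Fin d) → ℝ≥0∞} (hu : IsConvexLsc u)
    (hInt : ∫⁻ x, expNeg (u x) ≠ ∞) {z : EuclideanSpace ℝ (Fin d)} {ρ : ℝ} (hρ : 0 < ρ) {s : ℝ≥0}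
    (hs : ∀ x ∈ Metric.closedBall z ρ, u x ≤ s) :
    ∃ R : ℝ, 0 < R ∧ ∀ x, R ≤ ‖x - z‖ → (s : ℝ≥0∞) + 1 ≤ u x := by
  set V := volume (Metric.closedBall (0 : EuclideanSpace ℝ (Fin d)) (ρ / 2)) with hV
  have hV0 : 0 < V := Metric.measure_closedBall_pos _ _ (by positivity)
  have he0 : 0 < expNeg ((s : ℝ≥0∞) + 1) := expNeg_pos (by finiteness)
  obtain ⟨n, hn⟩ := ENNReal.exists_nat_mul_gt (mul_ne_zero hV0.ne' he0.ne') hInt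
  have hn0 : 0 < n := by
    rcases Nat.eq_zero_or_pos n with rfl | h
    · simp at hn
    · exact h
  have hn0' : (0 : ℝ) < n := by exact_mod_cast hn0
  -- The centres are `2 * ρ` apart and reach at most `2 * ρ * n`, half the distance to `x`. Hence
  -- the balls shrunk towards `x` still have radius at least `ρ / 2` there.
  refine ⟨4 * ρ * n, by positivity, fun x hx => ?_⟩
  by_contra! hux
  have ht : 0 < ‖x - z‖ := lt_of_lt_of_le (by positivity) hx
  set e := ‖x - z‖⁻¹ • (x - z) with he
  have hne : ‖e‖ = 1 := by
    rw [he, norm_smul, norm_inv, norm_norm, inv_mul_cancel₀ ht.ne']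
  set c : ℕ → EuclideanSpace ℝ (Fin d) := fun k => z + (2 * ρ * (k + 1)) • e with hc
  have hball : ∀ k ∈ Finset.range n, ∀ w ∈ Metric.closedBall (c k) (ρ / 2),
      u w ≤ (s : ℝ≥0∞) + 1 := by
    intro k hk w hw
    have hk' : (k : ℝ) + 1 ≤ n := by exact_mod_cast Finset.mem_range.1 hk
    set m := 2 * ρ * (k + 1) * ‖x - z‖⁻¹ with hm
    have hm0 : 0 < m := by positivity
    have hm2 : m ≤ 1 / 2 := by
      rw [hm, ← div_eq_mul_inv, div_le_iff₀ ht]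
      nlinarith
    have hck : c k = (1 - (1 - m)) • x + (1 - m) • z := by
      simp only [hc, he, smul_smul, ← hm]
      module
    have hw' : w ∈ Metric.closedBall ((1 - (1 - m)) • x + (1 - m) • z) ((1 - m) * ρ) := by
      rw [← hck]
      refine Metric.closedBall_subset_closedBall ?_ hw
      nlinarith
    refine (hu.le_on_shrunk_ball hs (by linarith) (by linarith) hw').trans ?_
    calc ENNReal.ofReal (1 - (1 - m)) * u x + ENNReal.ofReal (1 - m) * s
        ≤ ENNReal.ofReal (1 - (1 - m)) * (s + 1) + ENNReal.ofReal (1 - m) * (s + 1) := by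
          gcongr
          exact le_self_add
      _ = s + 1 := by
          rw [← add_mul, ← ENNReal.ofReal_add (by linarith) (by linarith)]
          simp
  have hdisj : ((Finset.range n : Finset ℕ) : Set ℕ).PairwiseDisjoint
      fun k => Metric.closedBall (c k) (ρ / 2) := by
    intro j _ k _ hjk
    refine Metric.closedBall_disjoint_closedBall ?_
    have h1 : c j - c k = (2 * ρ * ((j : ℝ) - k)) • e := by
      simp only [hc]; module
    have h2 : (1 : ℝ) ≤ |(j : ℝ) - k| := by
      have : (1 : ℤ) ≤ |(j : ℤ) - k| := Int.one_le_abs (by omega)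
      exact_mod_cast this
    rw [dist_eq_norm, h1, norm_smul, hne, mul_one, Real.norm_eq_abs, abs_mul,
      abs_of_pos (by positivity)]
    nlinarith
  have hvol : volume (⋃ k ∈ Finset.range n, Metric.closedBall (c k) (ρ / 2)) = n * V := by
    rw [measure_biUnion_finset hdisj fun k _ => Metric.isClosed_closedBall.measurableSet]
    simp_rw [Measure.addHaar_closedBall_center]
    simp [hV]
  have hle : (n : ℝ≥0∞) * (V * expNeg ((s : ℝ≥0∞) + 1)) ≤ ∫⁻ x, expNeg (u x) := by
    calc (n : ℝ≥0∞) * (V * expNeg ((s : ℝ≥0∞) + 1))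
        = ∫⁻ _ in ⋃ k ∈ Finset.range n, Metric.closedBall (c k) (ρ / 2),
            expNeg ((s : ℝ≥0∞) + 1) := by
          rw [setLIntegral_const, hvol]; ring
      _ ≤ ∫⁻ x in ⋃ k ∈ Finset.range n, Metric.closedBall (c k) (ρ / 2), expNeg (u x) := by
          refine setLIntegral_mono_ae' (Finset.measurableSet_biUnion _
            fun k _ => Metric.isClosed_closedBall.measurableSet) (ae_of_all _ fun w hw => ?_)
          simp only [mem_iUnion] at hw
          obtain ⟨k, hk, hwk⟩ := hw
          exact expNeg_antitone (hball k hk w hwk)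
      _ ≤ ∫⁻ x, expNeg (u x) := setLIntegral_le_lintegral _ _
  exact absurd hn hle.not_gt

/-- Along each ray from `z`, the exponent rises from at most `s` to at least `s + 1` within distance
`R`; by convexity it keeps growing at rate at least `1 / R`. -/
lemma IsConvexLsc.exists_linear_growth {u : EuclideanSpace ℝ (Fin d) → ℝ≥0∞} (hu : IsConvexLsc u)
    (hInt : ∫⁻ x, expNeg (u x) ≠ ∞) (hint0 : ∫⁻ x, expNeg (u x) ≠ 0) :
    ∃ (a b : ℝ), 0 < a ∧ ∀ x, ENNReal.ofReal (a * ‖x‖ - b) ≤ u x := by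
  obtain ⟨z, ρ, s, hρ, hs⟩ := hu.exists_le_on_ball hint0
  obtain ⟨R, hR, hRu⟩ := hu.exists_radius hInt hρ hs
  have hz : u z ≤ s := hs z (Metric.mem_closedBall_self hρ.le)
  have hfar : ∀ x, R < ‖x - z‖ → ENNReal.ofReal (R⁻¹ * ‖x - z‖) ≤ u x := by
    intro x hx
    have ht : 0 < ‖x - z‖ := hR.trans hx
    set m := R / ‖x - z‖ with hm
    have hm0 : 0 < m := by positivity
    have hm1 : m < 1 := (div_lt_one ht).2 hx
    have h1 := hu.convex z x (1 - m) m (by linarith) hm0 (by ring)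
    have h2 : (s : ℝ≥0∞) + 1 ≤ u ((1 - m) • z + m • x) := by
      refine hRu _ (le_of_eq ?_)
      rw [show (1 - m) • z + m • x - z = m • (x - z) by module, norm_smul,
        Real.norm_of_nonneg hm0.le, hm, div_mul_cancel₀ _ ht.ne']
    have h3 : (s : ℝ≥0∞) + 1 ≤ s + ENNReal.ofReal m * u x := by
      refine (h2.trans h1).trans ?_
      gcongr
      calc ENNReal.ofReal (1 - m) * u z ≤ ENNReal.ofReal 1 * s := by
            gcongr
            linarith
        _ = s := by simp
    have h4 : 1 ≤ ENNReal.ofReal m * u x := (ENNReal.add_le_add_iff_left ENNReal.coe_ne_top).1 h3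
    calc ENNReal.ofReal (R⁻¹ * ‖x - z‖) = ENNReal.ofReal m⁻¹ * 1 := by
          rw [mul_one, hm, inv_div, div_eq_inv_mul]
      _ ≤ ENNReal.ofReal m⁻¹ * (ENNReal.ofReal m * u x) := by gcongr
      _ = u x := by
          rw [← mul_assoc, ← ENNReal.ofReal_mul (by positivity), inv_mul_cancel₀ hm0.ne']
          simp
  refine ⟨R⁻¹, R⁻¹ * ‖z‖ + 1, by positivity, fun x => ?_⟩
  have htri : ‖x‖ ≤ ‖x - z‖ + ‖z‖ := by simpa using norm_add_le (x - z) z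
  have hRi : 0 < R⁻¹ := by positivity
  rcases le_or_gt ‖x - z‖ R with hx | hx
  · rw [ENNReal.ofReal_of_nonpos]
    · exact zero_le
    · have : R⁻¹ * ‖x - z‖ ≤ 1 := by rw [inv_mul_le_iff₀ hR]; linarith
      nlinarith
  · refine (ENNReal.ofReal_le_ofReal ?_).trans (hfar x hx)
    nlinarith

theorem IsLogConcaveDensity.memLp_two (hf : IsLogConcaveDensity f) :
    MemLp (fun x => x) 2 (densityMeasure f) := by
  refine ⟨measurable_id.aestronglyMeasurable, ?_⟩
  rw [eLpNorm_lt_top_iff_lintegral_rpow_enorm_lt_top (by norm_num) (by norm_num)]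
  obtain ⟨B, hB⟩ := hf.exists_logFun_le
  obtain ⟨a, b, ha, hab⟩ := (isConvexLsc_exponent B hf).exists_linear_growth
    (by rw [lintegral_expNeg_exponent hf hB]; finiteness)
    (hf.lintegral_expNeg_exponent_ne_zero B)
  -- Two of the `d + 3` powers absorb `‖x‖ ^ 2`; the remaining `d + 1` make the bound integrable in
  -- dimension `d`.
  obtain ⟨C, hC, hCt⟩ := exp_neg_mul_le_rpow ha (d + 3)
  have hbound : ∀ x, (f x : ℝ≥0∞) * ‖x‖ₑ ^ (2 : ℝ) ≤
      ENNReal.ofReal (Real.exp (B + b) * C * (1 + ‖x‖) ^ (-((d + 1 : ℕ) : ℝ))) := by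
    intro x
    have h1 : (f x : ℝ≥0∞) ≤ ENNReal.ofReal (Real.exp (B + b) * Real.exp (-(a * ‖x‖))) := by
      rw [coe_eq_of_logFun (logFun_eq_sub_exponent (hB x))]
      calc _ ≤ ENNReal.ofReal (Real.exp B) * expNeg (ENNReal.ofReal (a * ‖x‖ - b)) := by
            gcongr
            exact expNeg_antitone (hab x)
        _ ≤ ENNReal.ofReal (Real.exp B) * ENNReal.ofReal (Real.exp (-(a * ‖x‖ - b))) := by
            gcongr
            rcases le_total 0 (a * ‖x‖ - b) with h | h
            · rw [expNeg_ofReal h]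
            · rw [ENNReal.ofReal_of_nonpos h, expNeg_zero, ← ENNReal.ofReal_one]
              exact ENNReal.ofReal_le_ofReal (Real.one_le_exp (by linarith))
        _ = _ := by
            rw [← ENNReal.ofReal_mul (Real.exp_pos _).le, ← Real.exp_add, ← Real.exp_add]
            congr 2; ring
    have hx0 := norm_nonneg x
    rw [← ofReal_norm, ENNReal.ofReal_rpow_of_nonneg hx0 (by norm_num)]
    refine (mul_le_mul_left h1 _).trans ?_
    rw [← ENNReal.ofReal_mul (by positivity)]
    apply ENNReal.ofReal_le_ofReal
    have h2 : ‖x‖ ^ (2 : ℝ) ≤ (1 + ‖x‖) ^ (2 : ℝ) :=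
      Real.rpow_le_rpow hx0 (by linarith) (by norm_num)
    calc Real.exp (B + b) * Real.exp (-(a * ‖x‖)) * ‖x‖ ^ (2 : ℝ)
        ≤ Real.exp (B + b) * (C * (1 + ‖x‖) ^ (-((d + 3 : ℕ) : ℝ))) * (1 + ‖x‖) ^ (2 : ℝ) := by
          gcongr
          exact hCt _ hx0
      _ = Real.exp (B + b) * C *
          ((1 + ‖x‖) ^ (-((d + 3 : ℕ) : ℝ)) * (1 + ‖x‖) ^ (2 : ℝ)) := by ring
      _ = _ := by
          rw [← Real.rpow_add (by positivity)]
          congr 2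
          push_cast
          ring
  have hInt : Integrable (fun x : EuclideanSpace ℝ (Fin d) =>
      Real.exp (B + b) * C * (1 + ‖x‖) ^ (-((d + 1 : ℕ) : ℝ))) :=
    (integrable_one_add_norm (by simp)).const_mul _
  rw [densityMeasure, lintegral_withDensity_eq_lintegral_mul _ hf.measurable (by fun_prop)]
  refine lt_of_le_of_lt (lintegral_mono fun x => ?_) hInt.lintegral_lt_top
  simpa using hbound x

end Tail

/-! ### Second moments and covariance matrices -/

section SecondMoments

lemma IsProjection.lintegral_inner_sq_le (hP : MemPd P) (hf : IsProjection P f)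
    (v m : EuclideanSpace ℝ (Fin d)) :
    ∫⁻ x, ENNReal.ofReal ((inner ℝ v (x - m)) ^ 2) ∂(densityMeasure f) ≤
      ∫⁻ x, ENNReal.ofReal ((inner ℝ v (x - m)) ^ 2) ∂P := by
  refine hf.lintegral_le_of_ne_top hP (isConvexLsc_ofReal (by fun_prop) ?_)
    fun x => ENNReal.ofReal_ne_top
  refine ⟨convex_univ, fun x _ y _ a b ha hb hab => ?_⟩
  have h1 : a • x + b • y - m = a • (x - m) + b • (y - m) := by
    have : m = (a + b) • m := by rw [hab, one_smul]
    nth_rw 1 [this]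
    module
  beta_reduce
  rw [h1, inner_add_right, real_inner_smul_right, real_inner_smul_right]
  simp only [smul_eq_mul]
  generalize inner ℝ v (x - m) = p
  generalize inner ℝ v (y - m) = q
  have hb' : b = 1 - a := by linarith
  subst hb'
  nlinarith [mul_nonneg ha hb, sq_nonneg (p - q), mul_nonneg (mul_nonneg ha hb) (sq_nonneg (p - q))]

variable {Q : Measure (EuclideanSpace ℝ (Fin d))}

lemma memLp_coord_sub [IsFiniteMeasure Q] (hQ : MemLp (fun x => x) 2 Q)
    (m : EuclideanSpace ℝ (Fin d)) (i : Fin d) : MemLp (fun x => x i - m i) 2 Q := by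
  have h1 : MemLp (fun x => x - m) 2 Q := hQ.sub (memLp_const m)
  refine h1.mono (by fun_prop) (ae_of_all _ fun x => ?_)
  simpa using PiLp.norm_apply_le (x - m) i

lemma dotProduct_secondMomentMatrix [IsFiniteMeasure Q] (hQ : MemLp (fun x => x) 2 Q)
    (m : EuclideanSpace ℝ (Fin d)) (w : Fin d → ℝ) :
    w ⬝ᵥ (secondMomentMatrix Q m).mulVec w =
      (∫⁻ x, ENNReal.ofReal ((inner ℝ (WithLp.toLp 2 w) (x - m)) ^ 2) ∂Q).toReal := by
  have hInt : ∀ i j, Integrable (fun x => (x i - m i) * (x j - m j)) Q := fun i j =>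
    (memLp_coord_sub hQ m i).integrable_mul (memLp_coord_sub hQ m j)
  have hpt : ∀ x : EuclideanSpace ℝ (Fin d), (inner ℝ (WithLp.toLp 2 w) (x - m)) ^ 2 =
      ∑ i, ∑ j, w i * w j * ((x i - m i) * (x j - m j)) := by
    intro x
    rw [PiLp.inner_apply, sq, Finset.sum_mul_sum]
    refine Finset.sum_congr rfl fun i _ => Finset.sum_congr rfl fun j _ => ?_
    simp
    ring
  rw [← integral_eq_lintegral_of_nonneg_ae (ae_of_all _ fun x => sq_nonneg _) (by fun_prop)]
  simp_rw [hpt]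
  rw [integral_finsetSum _ fun i _ => integrable_finsetSum _ fun j _ => (hInt i j).const_mul _]
  rw [dotProduct]
  refine Finset.sum_congr rfl fun i _ => ?_
  rw [integral_finsetSum _ fun j _ => (hInt i j).const_mul _, Matrix.mulVec, dotProduct,
    Finset.mul_sum]
  refine Finset.sum_congr rfl fun j _ => ?_
  rw [integral_const_mul, secondMomentMatrix, Matrix.of_apply]
  ring

lemma isHermitian_secondMomentMatrix (m : EuclideanSpace ℝ (Fin d)) :
    (secondMomentMatrix Q m).IsHermitian := by
  ext i j
  simp only [secondMomentMatrix, Matrix.conjTranspose_apply, Matrix.of_apply, star_trivial]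
  simp_rw [mul_comm]

/-- The quadratic form of each matrix is a directional second moment, and these are ordered because
the squares are convex. -/
theorem IsProjection.posSemidef_sub (hP : MemPd P) (hf : IsProjection P f)
    (hP2 : MemLp (fun x => x) 2 P) (m : EuclideanSpace ℝ (Fin d)) :
    (secondMomentMatrix P m - secondMomentMatrix (densityMeasure f) m).PosSemidef := by
  have := hP.isProbabilityMeasure
  have := hf.1.isProbabilityMeasure
  refine Matrix.PosSemidef.of_dotProduct_mulVec_nonneg
    ((isHermitian_secondMomentMatrix m).sub (isHermitian_secondMomentMatrix m)) fun w => ?_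
  rw [star_trivial, Matrix.sub_mulVec, dotProduct_sub, dotProduct_secondMomentMatrix hP2,
    dotProduct_secondMomentMatrix hf.1.memLp_two, sub_nonneg]
  refine ENNReal.toReal_mono ?_ (hf.lintegral_inner_sq_le hP _ m)
  have h1 : MemLp (fun x => x - m) 2 P := hP2.sub (memLp_const m)
  have h2 : MemLp (fun x => inner ℝ (WithLp.toLp 2 w) (x - m)) 2 P := h1.const_inner _
  exact h2.integrable_sq.lintegral_lt_top.ne

end SecondMoments

end

end LogConcaveProjection

theorem mainTheorem3 {d : ℕ} (P : MeasureTheory.Measure (EuclideanSpace ℝ (Fin d)))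
    (hP : LogConcaveProjection.MemPd P) :
    (∃ f, LogConcaveProjection.IsProjection P f) ∧
    ∀ f, LogConcaveProjection.IsProjection P f →
      -- convex ordering; both extended integrals are well defined in `(-∞, ∞]`
      (∀ h : EuclideanSpace ℝ (Fin d) → EReal, LogConcaveProjection.IsExtConvex h →
        ∫⁻ x, (-h x).toENNReal ∂(LogConcaveProjection.densityMeasure f) < ∞ ∧
        ∫⁻ x, (-h x).toENNReal ∂P < ∞ ∧
        LogConcaveProjection.extIntegral (LogConcaveProjection.densityMeasure f) h ≤
          LogConcaveProjection.extIntegral P h) ∧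
      -- the mean is preserved
      Integrable (fun x => x) (LogConcaveProjection.densityMeasure f) ∧
      Integrable (fun x => x) P ∧
      ∫ x, x ∂(LogConcaveProjection.densityMeasure f) = ∫ x, x ∂P ∧
      -- the second moments about the mean shrink, in every direction
      MemLp (fun x => x) 2 (LogConcaveProjection.densityMeasure f) ∧
      (∀ v : EuclideanSpace ℝ (Fin d),
        ∫⁻ x, ENNReal.ofReal ((inner ℝ v (x - ∫ y, y ∂P)) ^ 2)
            ∂(LogConcaveProjection.densityMeasure f) ≤
          ∫⁻ x, ENNReal.ofReal ((inner ℝ v (x - ∫ y, y ∂P)) ^ 2) ∂P) ∧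
      -- the covariance matrix shrinks, when `P` has one
      (MemLp (fun x => x) 2 P →
        (LogConcaveProjection.secondMomentMatrix P (∫ y, y ∂P) -
          LogConcaveProjection.secondMomentMatrix (LogConcaveProjection.densityMeasure f)
            (∫ y, y ∂P)).PosSemidef) := by
  have := hP.isProbabilityMeasure
  refine ⟨hP.exists_isProjection, fun f hf => ?_⟩
  have := hf.1.isProbabilityMeasure
  exact ⟨fun h hh => ⟨hh.lintegral_neg_lt_top (hf.integrable_id hP),
      hh.lintegral_neg_lt_top hP.integrable_id, hf.extIntegral_le hP hh⟩,
    hf.integrable_id hP, hP.integrable_id, hf.integral_id_eq hP, hf.1.memLp_two,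
    fun v => hf.lintegral_inner_sq_le hP v _, fun hP2 => hf.posSemidef_sub hP hP2 _⟩
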